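/- Let $H$ be the space of complex-valued $C^\infty$ functions on the unit circle $S^1$ with mean value $0$, with the bilinear form $\omega(u,v)=\frac1{2\pi}\int_0^{2\pi}u\,v'\,d\theta$, the Hilbert transform $J$ ($Je^{in\theta}=i\,\mathrm{sgn}(n)e^{in\theta}$), and the inner product $(u,v)_\omega=-\omega(u,J\bar v)$ with norm $\|\cdot\|_\omega$. For $n\in\mathbb Z\setminus\{0\}$ put $\tilde e_n=\frac1{\sqrt n}e^{in\theta}$ if $n>0$ and $\tilde e_n=\frac1{i\sqrt{|n|}}e^{in\theta}$ if $n<0$; these are orthonormal for $(\cdot,\cdot)_\omega$. For a linear operator $A$ on $H$ put $A_{m,n}=(A\tilde e_n,\tilde e_m)_\omega$ and $\bar Au=\overline{A\bar u}$. Let $\operatorname{Sp}(\infty)$ be the set of operators $A$ on $H$ that are bounded for $\|\cdot\|_\omega$, invertible (with bounded inverse on $H$), real ($A=\bar A$), preserve the form ($\omega(Au,Av)=\omega(u,v)$ for all $u,v\in H$), and whose off-diagonal block is Hilbert--Schmidt: $\sum_{m>0,\,n<0}|A_{m,n}|^2<\infty$. Let $\operatorname{Diff}(S^1)$ be the group of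 orientation preserving $C^\infty$ diffeomorphisms of $S^1$, and for $\phi\in\operatorname{Diff}(S^1)$, $u\in H$ let $$(\Phi(\phi)u)(\theta)=u(\phi^{-1}(\theta))-\frac1{2\pi}\int_0^{2\pi}u(\phi^{-1}(\theta))\,d\theta .$$ Then $\operatorname{Sp}(\infty)$ is a group under composition, $\Phi$ maps $\operatorname{Diff}(S^1)$ into $\operatorname{Sp}(\infty)$, and $\Phi:\operatorname{Diff}(S^1)\to\operatorname{Sp}(\infty)$ is an injective group homomorphism that is not surjective. More precisely, for every $\phi\in\operatorname{Diff}(S^1)$ the image of the function $\Phi(\phi)e^{i\theta}:S^1\to\mathbb C$ is a circle of radius $1$, whereas there is an operator $A\in\operatorname{Sp}(\infty)$ with $A_{1,1}=A_{-1,-1}=\sqrt2$, $A_{1,-1}=i$, $A_{-1,1}=-i$, $A_{m,m}=1$ for $m\ne\pm1$ and all other entries $0$, for which the image of $Ae^{i\theta}$ is the ellipse $\frac{x^2}{(\sqrt2-1)^2}+\frac{y^2}{(\sqrt2+1)^2}=1$, which is not a circle of radius $1$; hence $A$ is not in the image of $\Phi$. -/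

import Mathlib

open scoped Manifold ContDiff

noncomputable section

namespace SymplecticCircle

/-- Smooth (`C^∞`) complex-valued functions on the unit circle. -/
def IsSmooth (u : Circle → ℂ) : Prop := ContMDiff (𝓡 1) 𝓘(ℝ, ℂ) ∞ u

/-- The mean value `(1/2π) ∫₀^{2π} u(e^{iθ}) dθ`. -/
def mean (u : Circle → ℂ) : ℂ :=
  (1 / (2 * (Real.pi : ℂ))) * ∫ θ in (0 : ℝ)..(2 * Real.pi), u (Circle.exp θ)

lemma IsSmooth.intervalIntegrable {u : Circle → ℂ} (hu : IsSmooth u) :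
    IntervalIntegrable (fun θ : ℝ => u (Circle.exp θ)) MeasureTheory.volume 0 (2 * Real.pi) :=
  (hu.continuous.comp Circle.exp.continuous).intervalIntegrable _ _

lemma IsSmooth.postcomp {u : Circle → ℂ} (hu : IsSmooth u) {g : ℂ → ℂ} (hg : ContDiff ℝ ∞ g) :
    IsSmooth (fun z => g (u z)) :=
  ContMDiff.comp hg.contMDiff hu

lemma isSmooth_zpow (n : ℤ) : IsSmooth (fun z : Circle => (z : ℂ) ^ n) := by
  have := finrank_real_complex_fact'
  have hc : IsSmooth (fun z : Circle => (z : ℂ)) := contMDiff_coe_sphere (E := ℂ) (n := 1)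
  intro z
  have h : ContDiffAt ℝ ∞ (fun w : ℂ => w ^ n) (z : ℂ) := by
    have hz : (z : ℂ) ≠ 0 := Circle.coe_ne_zero z
    cases n with
    | ofNat k => simpa using (contDiff_id.pow k).contDiffAt
    | negSucc k =>
      simp only [zpow_negSucc]
      exact ContDiffAt.inv (contDiff_id.pow (k + 1)).contDiffAt (pow_ne_zero (k + 1) hz)
  exact ContMDiffAt.comp z h.contMDiffAt (hc z)

/-- The space `H` of smooth complex-valued functions on the circle with mean value zero. -/
def H : Submodule ℂ (Circle → ℂ) where
  carrier := {u | IsSmooth u ∧ mean u = 0}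
  zero_mem' := ⟨contMDiff_const, by simp [mean]⟩
  add_mem' := by
    rintro u v ⟨hu, hu0⟩ ⟨hv, hv0⟩
    refine ⟨ContMDiff.add hu hv, ?_⟩
    have : mean (u + v) = mean u + mean v := by
      simp only [mean, Pi.add_apply]
      rw [intervalIntegral.integral_add hu.intervalIntegrable hv.intervalIntegrable, mul_add]
    rw [this, hu0, hv0, add_zero]
  smul_mem' := by
    rintro c u ⟨hu, hu0⟩
    refine ⟨hu.postcomp (g := fun w => c * w) (contDiff_const.mul contDiff_id), ?_⟩
    have : mean (c • u) = c * mean u := by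
      simp only [mean, Pi.smul_apply, smul_eq_mul]
      rw [intervalIntegral.integral_const_mul]
      ring
    rw [this, hu0, mul_zero]

/-- Complex conjugation `u ↦ ū` on `H`. -/
def conjH (u : H) : H :=
  ⟨fun z => (starRingEnd ℂ) (u.1 z),
    u.2.1.postcomp (g := fun w => (starRingEnd ℂ) w) Complex.conjCLE.contDiff, by
      have h : mean (fun z => (starRingEnd ℂ) (u.1 z)) = (starRingEnd ℂ) (mean u.1) := by
        simp only [mean, map_mul, map_div₀, map_one, map_ofNat, Complex.conj_ofReal]
        congr 1
        rw [intervalIntegral.integral_of_le (by positivity),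
          intervalIntegral.integral_of_le (by positivity), integral_conj]
      rw [h, u.2.2, map_zero]⟩

/-- The derivative `u' = du/dθ`, as a function of the angle `θ`. -/
def dTheta (u : Circle → ℂ) (θ : ℝ) : ℂ := deriv (fun t : ℝ => u (Circle.exp t)) θ

/-- The form `ω(u, v) = (1/2π) ∫₀^{2π} u v' dθ`. -/
def omega (u v : Circle → ℂ) : ℂ :=
  (1 / (2 * (Real.pi : ℂ))) *
    ∫ θ in (0 : ℝ)..(2 * Real.pi), u (Circle.exp θ) * dTheta v θ

/-- The Fourier coefficient `û(n) = (1/2π) ∫₀^{2π} u(θ) e^{-inθ} dθ`. -/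
def fourierCoeffCircle (u : Circle → ℂ) (n : ℤ) : ℂ := mean (fun z => u z * (z : ℂ) ^ (-n))

/-- The Hilbert transform `J`: the Fourier multiplier `ê_n ↦ i sgn(n) ê_n`. (On smooth functions
the series converges absolutely.) -/
def hilbertJ (u : Circle → ℂ) (z : Circle) : ℂ :=
  ∑' n : ℤ, Complex.I * (n.sign : ℂ) * fourierCoeffCircle u n * (z : ℂ) ^ n

/-- The inner product `(u, v)_ω = -ω(u, J v̄)` on `H`. -/
def innerOmega (u v : H) : ℂ := -omega u.1 (hilbertJ (conjH v).1)

/-- The norm `‖u‖_ω = √(u, u)_ω`. -/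
def normOmega (u : H) : ℝ := Real.sqrt (innerOmega u u).re

/-- Nonzero integers, the index set of the bases. -/
abbrev NZ : Type := {n : ℤ // n ≠ 0}

lemma mean_zpow {n : ℤ} (hn : n ≠ 0) : mean (fun z => (z : ℂ) ^ n) = 0 := by
  have hc : (n : ℂ) * Complex.I ≠ 0 := by simp [hn]
  have h : ∀ θ : ℝ, ((Circle.exp θ : Circle) : ℂ) ^ n
      = Complex.exp ((n : ℂ) * Complex.I * (θ : ℂ)) := by
    intro θ
    rw [Circle.coe_exp, ← Complex.exp_int_mul]
    ring_nf
  simp only [mean, h]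
  rw [integral_exp_mul_complex hc]
  have h2 : Complex.exp ((n : ℂ) * Complex.I * ((2 * Real.pi : ℝ) : ℂ)) = 1 := by
    rw [Complex.exp_eq_one_iff]
    exact ⟨n, by push_cast; ring⟩
  simp only [h2, Complex.ofReal_zero, mul_zero, Complex.exp_zero, sub_self, zero_div]

/-- The function `ê_n = e^{inθ}`, `n ≠ 0`, as an element of `H`. -/
def eHat (n : NZ) : H := ⟨fun z => (z : ℂ) ^ n.1, isSmooth_zpow n.1, mean_zpow n.2⟩

/-- The basis vector `ẽ_n`: `e^{inθ} / √n` for `n > 0` and `e^{inθ} / (i √|n|)` for `n < 0`. -/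
def eTilde (n : NZ) : H :=
  (if 0 < n.1 then 1 / (Real.sqrt (n.1 : ℝ) : ℂ)
    else 1 / (Complex.I * (Real.sqrt |(n.1 : ℝ)| : ℂ))) • eHat n

/-- The matrix entry `A_{m,n} = (A ẽ_n, ẽ_m)_ω`. -/
def matrixEntry (A : H →ₗ[ℂ] H) (m n : NZ) : ℂ := innerOmega (A (eTilde n)) (eTilde m)

/-- `A` is a bounded operator on `H` for the norm `‖·‖_ω`. -/
def IsBoundedOp (A : H →ₗ[ℂ] H) : Prop := ∃ C : ℝ, ∀ u : H, normOmega (A u) ≤ C * normOmega u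

/-- `A = Ā`, where `Ā u` is the conjugate of `A ū`. -/
def IsRealOp (A : H →ₗ[ℂ] H) : Prop := ∀ u : H, A u = conjH (A (conjH u))

/-- `A` preserves the form `ω`. -/
def PreservesOmega (A : H →ₗ[ℂ] H) : Prop :=
  ∀ u v : H, omega (A u).1 (A v).1 = omega u.1 v.1

/-- The block `b = π⁺ A π⁻` is Hilbert–Schmidt: `∑_{m > 0, n < 0} |A_{m,n}|² < ∞`, where the
`ẽ_n` are orthonormal for `(·,·)_ω`. -/
def OffDiagonalHilbertSchmidt (A : H →ₗ[ℂ] H) : Prop :=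
  Summable fun p : {m : NZ // 0 < m.1} × {n : NZ // n.1 < 0} =>
    ‖matrixEntry A p.1.1 p.2.1‖ ^ 2

/-- `Sp(∞)`: the invertible elements `A` of the algebra of bounded operators on `H` that are real,
preserve `ω`, and have a Hilbert–Schmidt off-diagonal block. It is a subset of the group
`H ≃ₗ[ℂ] H` of linear automorphisms of `H`, whose product is composition. -/
def SpInf : Set (H ≃ₗ[ℂ] H) :=
  {A | IsBoundedOp A.toLinearMap ∧ IsBoundedOp A.symm.toLinearMap ∧ IsRealOp A.toLinearMap ∧
    PreservesOmega A.toLinearMap ∧ OffDiagonalHilbertSchmidt A.toLinearMap}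

/-- `Diff(S¹)`: the group (under composition) of orientation preserving `C^∞` diffeomorphisms of
the circle. A diffeomorphism preserves the orientation if it lifts along `t ↦ e^{it}` to an
increasing bijection of the line. -/
def DiffS1 : Subgroup (Equiv.Perm Circle) where
  carrier := {φ | ContMDiff (𝓡 1) (𝓡 1) ∞ φ ∧ ContMDiff (𝓡 1) (𝓡 1) ∞ φ.symm ∧
    ∃ f : ℝ ≃o ℝ, ∀ t : ℝ, φ (Circle.exp t) = Circle.exp (f t)}
  one_mem' := ⟨contMDiff_id, contMDiff_id, OrderIso.refl ℝ, fun _ => rfl⟩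
  mul_mem' := by
    rintro φ ψ ⟨hφ, hφ', f, hf⟩ ⟨hψ, hψ', g, hg⟩
    exact ⟨hφ.comp hψ, hψ'.comp hφ', g.trans f, fun t => by simp [hg, hf]⟩
  inv_mem' := by
    rintro φ ⟨hφ, hφ', f, hf⟩
    refine ⟨hφ', hφ, f.symm, fun t => ?_⟩
    change φ.symm (Circle.exp t) = _
    rw [Equiv.symm_apply_eq, hf, OrderIso.apply_symm_apply]

/-- The action `(φ.u)(θ) = u(φ⁻¹(θ)) - (1/2π) ∫₀^{2π} u(φ⁻¹(θ)) dθ`. -/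
def diffAct (φ : DiffS1) (u : Circle → ℂ) : Circle → ℂ :=
  fun z => u (φ.1.symm z) - mean (fun w => u (φ.1.symm w))

/-- The index `1`. -/
def idxOne : NZ := ⟨1, by norm_num⟩

/-- The index `-1`. -/
def idxNegOne : NZ := ⟨-1, by norm_num⟩

/-- The matrix with `A_{1,1} = A_{-1,-1} = √2`, `A_{1,-1} = i`, `A_{-1,1} = -i`, `A_{m,m} = 1` for
`m ≠ ±1`, and all other entries `0`. -/
def ellipseMatrix (m n : NZ) : ℂ :=
  if m = n then (if m = idxOne ∨ m = idxNegOne then (Real.sqrt 2 : ℂ) else 1)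
  else if m = idxOne ∧ n = idxNegOne then Complex.I
  else if m = idxNegOne ∧ n = idxOne then -Complex.I
  else 0

/-- The ellipse `x² / (√2 - 1)² + y² / (√2 + 1)² = 1` in the complex plane. -/
def ellipse : Set ℂ :=
  {z | z.re ^ 2 / (Real.sqrt 2 - 1) ^ 2 + z.im ^ 2 / (Real.sqrt 2 + 1) ^ 2 = 1}

end SymplecticCircle

end

open SymplecticCircle

noncomputable section

namespace SymplecticCircle

/-! ### Smooth functions on the circle -/

/-! Everything is read off Fourier coefficients. Elements of `H` correspond to rapidly decreasing
sequences vanishing at 0, with ω(u,v) = Σ -in û(n) v̂(-n) and ‖u‖² = `energy u` = Σ |n| |û(n)|².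

For the group structure, the point is that boundedness is automatic (`mem_SpInf_iff`). Since Im ω(w,
w̄) = -Σ n |ŵ(n)|² equals `energy w` minus twice the energy of the positive part of w, and a real
operator preserving ω leaves this number fixed, a purely negative w satisfies ‖Aw‖² = ‖w‖² +
2‖(Aw)₊‖². The last term is controlled by the Hilbert–Schmidt block (`exists_energy_le`), and
conjugation handles positive w. The form also identifies, up to weights, the entry (m, n) of A⁻¹
with the entry (-n, -m) of A, so blocks of inverses are Hilbert–Schmidt. The block of AB splits into
"bounded after Hilbert–Schmidt" and a second term that ω-duality brings to the same shape.

For Φ(φ), invariance of ω is a change of variables. The entries with m > 0 > n are oscillatory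
integrals of exp(i(n g(t) - m t)), where g lifts φ⁻¹; the phase derivative never vanishes and has
size at least a constant times m + |n|, so two integrations by parts give quadratic decay
(`exists_coef_diffLin_le`), which is square summable with the weights.

Finally, Φ(φ) e^{iθ} is φ⁻¹, viewed as a map into ℂ, minus a constant. This gives unit circles as
images, and injectivity because distinct translates of the unit circle are different sets. A
hyperbolic rotation of the modes ±1 sends e^{iθ} to √2 z - z̄, whose image is an ellipse of diameter
greater than 2. -/

lemma isSmooth_coe : IsSmooth (fun z : Circle => (z : ℂ)) := by
  simpa using isSmooth_zpow 1

lemma IsSmooth.contDiff {u : Circle → ℂ} (hu : IsSmooth u) :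
    ContDiff ℝ ∞ (fun t : ℝ => u (Circle.exp t)) :=
  contMDiff_iff_contDiff.1 (ContMDiff.comp hu contMDiff_circleExp)

/-- The angle of `z` measured from `z₀` is smooth near `z₀`. -/
lemma contMDiffAt_relative_arg (z₀ : Circle) :
    ContMDiffAt (𝓡 1) 𝓘(ℝ, ℝ) ∞ (fun z : Circle => Complex.arg ((z / z₀ : Circle) : ℂ)) z₀ := by
  have h1 : ContDiffAt ℝ ∞ (fun w : ℂ => (Complex.log (w / (z₀ : ℂ))).im) (z₀ : ℂ) := by
    have hlog : ContDiffAt ℝ ∞ Complex.log ((z₀ : ℂ) / (z₀ : ℂ)) := by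
      rw [div_self (Circle.coe_ne_zero z₀)]
      exact (Complex.contDiffAt_log Complex.one_mem_slitPlane).restrict_scalars ℝ
    have hd : ContDiffAt ℝ ∞ (fun w : ℂ => w / (z₀ : ℂ)) (z₀ : ℂ) := contDiffAt_id.div_const _
    have hl := ContDiffAt.comp (g := Complex.log) (f := fun w : ℂ => w / (z₀ : ℂ)) (z₀ : ℂ)
      hlog hd
    exact ContDiffAt.comp (g := Complex.imCLM) (z₀ : ℂ) Complex.imCLM.contDiff.contDiffAt hl
  have h2 := ContMDiffAt.comp z₀ h1.contMDiffAt (isSmooth_coe z₀)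
  refine h2.congr_of_eventuallyEq (Filter.Eventually.of_forall fun z => ?_)
  simp [Complex.log_im]
  rfl

/-- The function z ↦ arg z₀ + arg (z / z₀) is a section of `Circle.exp` that is smooth at z₀,
including z₀ = -1, where `Complex.arg` itself jumps. Composing with it descends smoothness from the
line to the circle. -/
lemma isSmooth_iff_contDiff {u : Circle → ℂ} :
    IsSmooth u ↔ ContDiff ℝ ∞ (fun t : ℝ => u (Circle.exp t)) := by
  refine ⟨fun h => h.contDiff, fun h z₀ => ?_⟩
  have h1 : ContMDiffAt (𝓡 1) 𝓘(ℝ, ℝ) ∞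
      (fun z : Circle => Complex.arg (z₀ : ℂ) + Complex.arg ((z / z₀ : Circle) : ℂ)) z₀ :=
    contMDiffAt_const.add (contMDiffAt_relative_arg z₀)
  have h2 := ContMDiffAt.comp z₀ (h.contMDiff.contMDiffAt) h1
  refine h2.congr_of_eventuallyEq (Filter.Eventually.of_forall fun z => ?_)
  simp only [Function.comp_apply, Circle.exp_add, Circle.exp_arg, mul_div_cancel]

/-- A continuous real function whose exponential on the circle is smooth is smooth. -/
lemma contDiff_of_circleExp {f : ℝ → ℝ} (hf : Continuous f)
    (h : ContDiff ℝ ∞ (fun t => (Circle.exp (f t) : ℂ))) : ContDiff ℝ ∞ f := by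
  rw [contDiff_iff_contDiffAt]
  intro t₀
  have h1 : ContDiffAt ℝ ∞
      (fun t => f t₀ + (Complex.log ((Circle.exp (f t) : ℂ) / (Circle.exp (f t₀) : ℂ))).im) t₀ := by
    have hlog : ContDiffAt ℝ ∞ Complex.log
        ((Circle.exp (f t₀) : ℂ) / (Circle.exp (f t₀) : ℂ)) := by
      rw [div_self (Circle.coe_ne_zero _)]
      exact (Complex.contDiffAt_log Complex.one_mem_slitPlane).restrict_scalars ℝ
    have hd : ContDiffAt ℝ ∞ (fun t => (Circle.exp (f t) : ℂ) / (Circle.exp (f t₀) : ℂ)) t₀ :=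
      h.contDiffAt.div_const _
    have hl := ContDiffAt.comp (g := Complex.log) t₀ hlog hd
    exact contDiffAt_const.add
      (ContDiffAt.comp (g := Complex.imCLM) t₀ Complex.imCLM.contDiff.contDiffAt hl)
  refine h1.congr_of_eventuallyEq ?_
  -- Within distance π the principal logarithm recovers f t - f t₀ exactly.
  have hnear : ∀ᶠ t in nhds t₀, |f t - f t₀| < Real.pi := by
    have : ContinuousAt (fun t => |f t - f t₀|) t₀ := by fun_prop
    exact this.eventually_lt continuousAt_const (by simpa using Real.pi_pos)
  filter_upwards [hnear] with t ht
  rw [abs_lt] at ht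
  rw [← Circle.coe_div, ← Circle.exp_sub, Complex.log_im, Circle.arg_exp ht.1 ht.2.le]
  ring

lemma isSmooth_const (c : ℂ) : IsSmooth (fun _ => c) := contMDiff_const

lemma IsSmooth.mul {u v : Circle → ℂ} (hu : IsSmooth u) (hv : IsSmooth v) :
    IsSmooth (fun z => u z * v z) :=
  isSmooth_iff_contDiff.2 (hu.contDiff.mul hv.contDiff)

lemma IsSmooth.sub {u v : Circle → ℂ} (hu : IsSmooth u) (hv : IsSmooth v) :
    IsSmooth (fun z => u z - v z) :=
  isSmooth_iff_contDiff.2 (hu.contDiff.sub hv.contDiff)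

/-- The derivative `du/dθ` as a function on the circle. -/
def circleDeriv (u : Circle → ℂ) (z : Circle) : ℂ := dTheta u (Complex.arg z)

lemma dTheta_periodic (u : Circle → ℂ) : Function.Periodic (dTheta u) (2 * Real.pi) := by
  intro t
  have h := deriv_comp_add_const (fun t : ℝ => u (Circle.exp t)) (2 * Real.pi) t
  simp only [Circle.periodic_exp _] at h
  exact h.symm

/-- The principal angle in `circleDeriv` differs from t by a multiple of 2π, a period of `dTheta u`.
-/
lemma circleDeriv_exp (u : Circle → ℂ) (t : ℝ) : circleDeriv u (Circle.exp t) = dTheta u t := by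
  obtain ⟨m, hm⟩ := Circle.exp_eq_exp.1 (Circle.exp_arg (Circle.exp t))
  rw [circleDeriv, hm]
  exact (dTheta_periodic u).int_mul m t

lemma IsSmooth.circleDeriv {u : Circle → ℂ} (hu : IsSmooth u) : IsSmooth (circleDeriv u) := by
  rw [isSmooth_iff_contDiff]
  simp only [circleDeriv_exp]
  exact (contDiff_infty_iff_deriv.1 hu.contDiff).2

lemma IsSmooth.hasDerivAt {u : Circle → ℂ} (hu : IsSmooth u) (t : ℝ) :
    HasDerivAt (fun t : ℝ => u (Circle.exp t)) (dTheta u t) t :=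
  ((contDiff_infty_iff_deriv.1 hu.contDiff).1 t).hasDerivAt

lemma IsSmooth.continuous_dTheta {u : Circle → ℂ} (hu : IsSmooth u) : Continuous (dTheta u) :=
  (contDiff_infty_iff_deriv.1 hu.contDiff).2.continuous

/-! ### The mean value -/

lemma omega_eq_mean (u v : Circle → ℂ) : omega u v = mean (fun z => u z * circleDeriv v z) := by
  simp only [omega, mean, circleDeriv_exp]

lemma mean_add {u v : Circle → ℂ} (hu : IsSmooth u) (hv : IsSmooth v) :
    mean (fun z => u z + v z) = mean u + mean v := by
  simp only [mean]
  rw [intervalIntegral.integral_add hu.intervalIntegrable hv.intervalIntegrable, mul_add]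

lemma mean_sub {u v : Circle → ℂ} (hu : IsSmooth u) (hv : IsSmooth v) :
    mean (fun z => u z - v z) = mean u - mean v := by
  simp only [mean]
  rw [intervalIntegral.integral_sub hu.intervalIntegrable hv.intervalIntegrable, mul_sub]

lemma mean_const_mul (c : ℂ) (u : Circle → ℂ) : mean (fun z => c * u z) = c * mean u := by
  simp only [mean, intervalIntegral.integral_const_mul]
  ring

lemma mean_const (c : ℂ) : mean (fun _ => c) = c := by
  have : (Real.pi : ℂ) ≠ 0 := by exact_mod_cast Real.pi_ne_zero
  simp [mean]
  field_simp

lemma mean_conj (u : Circle → ℂ) :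
    mean (fun z => (starRingEnd ℂ) (u z)) = (starRingEnd ℂ) (mean u) := by
  simp only [mean, map_mul, map_div₀, map_one, map_ofNat, Complex.conj_ofReal]
  congr 1
  rw [intervalIntegral.integral_of_le (by positivity),
    intervalIntegral.integral_of_le (by positivity), integral_conj]

lemma norm_mean_le {u : Circle → ℂ} {C : ℝ} (h : ∀ z, ‖u z‖ ≤ C) : ‖mean u‖ ≤ C := by
  have h1 := intervalIntegral.norm_integral_le_of_norm_le_const (a := 0) (b := 2 * Real.pi)
    (f := fun θ : ℝ => u (Circle.exp θ)) (C := C) (fun θ _ => h _)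
  have hpi := Real.pi_pos
  rw [sub_zero, abs_of_pos (by positivity)] at h1
  rw [mean, norm_mul]
  have h2 : ‖(1 / (2 * (Real.pi : ℂ)))‖ = 1 / (2 * Real.pi) := by
    simp [abs_of_pos hpi]
  rw [h2, one_div_mul_eq_div, div_le_iff₀ (by positivity)]
  exact h1

/-- Termwise integration of a dominated series of continuous functions. -/
lemma hasSum_mean {F : ℤ → Circle → ℂ} {G : Circle → ℂ} {b : ℤ → ℝ} (hF : ∀ n, Continuous (F n))
    (hb : ∀ n z, ‖F n z‖ ≤ b n) (hs : Summable b) (hG : ∀ z, HasSum (fun n => F n z) (G z)) :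
    HasSum (fun n => mean (F n)) (mean G) := by
  refine HasSum.mul_left _ ?_
  refine intervalIntegral.hasSum_integral_of_dominated_convergence (fun n _ => b n)
    (fun n => ((hF n).comp Circle.exp.continuous).aestronglyMeasurable)
    (fun n => Filter.Eventually.of_forall fun t _ => hb n _)
    (Filter.Eventually.of_forall fun t _ => hs) intervalIntegrable_const
    (Filter.Eventually.of_forall fun t _ => hG _)

/-- Integration by parts on the circle. -/
lemma mean_mul_circleDeriv {u v : Circle → ℂ} (hu : IsSmooth u) (hv : IsSmooth v) :
    mean (fun z => u z * circleDeriv v z) = - mean (fun z => circleDeriv u z * v z) := by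
  simp only [mean, circleDeriv_exp]
  rw [intervalIntegral.integral_mul_deriv_eq_deriv_mul (fun t _ => hu.hasDerivAt t)
    (fun t _ => hv.hasDerivAt t) (hu.continuous_dTheta.intervalIntegrable _ _)
    (hv.continuous_dTheta.intervalIntegrable _ _)]
  simp

lemma omega_antisymm {u v : Circle → ℂ} (hu : IsSmooth u) (hv : IsSmooth v) :
    omega u v = - omega v u := by
  rw [omega_eq_mean, omega_eq_mean, mean_mul_circleDeriv hu hv]
  simp only [mul_comm]

lemma coe_exp_zpow (t : ℝ) (n : ℤ) :
    (Circle.exp t : ℂ) ^ n = Complex.exp ((n : ℂ) * Complex.I * (t : ℂ)) := by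
  rw [Circle.coe_exp, ← Complex.exp_int_mul]
  ring_nf

lemma hasDerivAt_exp_zpow (n : ℤ) (t : ℝ) :
    HasDerivAt (fun t : ℝ => (Circle.exp t : ℂ) ^ n)
      ((n : ℂ) * Complex.I * (Circle.exp t : ℂ) ^ n) t := by
  simp only [coe_exp_zpow]
  have h := ((hasDerivAt_id (t : ℂ)).const_mul ((n : ℂ) * Complex.I)).cexp.comp_ofReal
  simpa [mul_comm] using h

lemma circleDeriv_zpow (n : ℤ) :
    circleDeriv (fun z : Circle => (z : ℂ) ^ n) =
      fun z : Circle => (n : ℂ) * Complex.I * (z : ℂ) ^ n := by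
  funext z
  rw [← Circle.exp_arg z, circleDeriv_exp, dTheta, (hasDerivAt_exp_zpow n _).deriv]

/-! ### Fourier coefficients -/

lemma fourierCoeffCircle_add {u v : Circle → ℂ} (hu : IsSmooth u) (hv : IsSmooth v) (n : ℤ) :
    fourierCoeffCircle (fun z => u z + v z) n =
      fourierCoeffCircle u n + fourierCoeffCircle v n := by
  simp only [fourierCoeffCircle, add_mul]
  exact mean_add (hu.mul (isSmooth_zpow _)) (hv.mul (isSmooth_zpow _))

lemma fourierCoeffCircle_const_mul (c : ℂ) (u : Circle → ℂ) (n : ℤ) :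
    fourierCoeffCircle (fun z => c * u z) n = c * fourierCoeffCircle u n := by
  simp only [fourierCoeffCircle, mul_assoc]
  exact mean_const_mul _ _

lemma fourierCoeffCircle_conj (u : Circle → ℂ) (n : ℤ) :
    fourierCoeffCircle (fun z => (starRingEnd ℂ) (u z)) n =
      (starRingEnd ℂ) (fourierCoeffCircle u (-n)) := by
  rw [fourierCoeffCircle, fourierCoeffCircle, ← mean_conj]
  congr 1
  funext z
  rw [map_mul, map_zpow₀, ← Circle.coe_inv_eq_conj, Circle.coe_inv, inv_zpow', neg_neg]

lemma fourierCoeffCircle_zpow (m n : ℤ) :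
    fourierCoeffCircle (fun z => (z : ℂ) ^ m) n = if m = n then 1 else 0 := by
  have h : ∀ z : Circle, (z : ℂ) ^ m * (z : ℂ) ^ (-n) = (z : ℂ) ^ (m - n) := fun z => by
    rw [← zpow_add₀ (Circle.coe_ne_zero z), sub_eq_add_neg]
  simp only [fourierCoeffCircle, h]
  split_ifs with hmn
  · simp [hmn, mean_const]
  · exact mean_zpow (sub_ne_zero.2 hmn)

lemma fourierCoeffCircle_circleDeriv {u : Circle → ℂ} (hu : IsSmooth u) (n : ℤ) :
    fourierCoeffCircle (circleDeriv u) n = (n : ℂ) * Complex.I * fourierCoeffCircle u n := by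
  have h := mean_mul_circleDeriv hu (isSmooth_zpow (-n))
  rw [circleDeriv_zpow] at h
  have h2 : (fun z : Circle => u z * ((((-n : ℤ) : ℂ) * Complex.I) * (z : ℂ) ^ (-n))) =
      fun z : Circle => -((n : ℂ) * Complex.I) * (u z * (z : ℂ) ^ (-n)) := by
    funext z
    push_cast
    ring
  rw [h2, mean_const_mul] at h
  rw [fourierCoeffCircle, fourierCoeffCircle]
  linear_combination h

lemma omega_zpow {u : Circle → ℂ} (n : ℤ) :
    omega u (fun z => (z : ℂ) ^ n) = (n : ℂ) * Complex.I * fourierCoeffCircle u (-n) := by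
  rw [omega_eq_mean, circleDeriv_zpow, fourierCoeffCircle, neg_neg, ← mean_const_mul]
  congr 1
  funext z
  ring

/-- Sequences decaying faster than any power. -/
def RapidDecay (c : ℤ → ℂ) : Prop := ∀ k : ℕ, ∃ C : ℝ, ∀ n : ℤ, |(n : ℝ)| ^ k * ‖c n‖ ≤ C

/-- Differentiation multiplies the n-th coefficient by in, so each extra power of |n| is paid for by
passing to the derivative. -/
lemma rapidDecay_fourierCoeffCircle {u : Circle → ℂ} (hu : IsSmooth u) :
    RapidDecay (fourierCoeffCircle u) := by
  intro k
  induction k generalizing u with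
  | zero =>
    obtain ⟨C, hC⟩ := (isCompact_univ (X := Circle)).exists_bound_of_continuousOn
      hu.continuous.continuousOn
    refine ⟨C, fun n => ?_⟩
    rw [pow_zero, one_mul]
    refine norm_mean_le fun z => ?_
    simpa [Circle.norm_coe] using hC z (Set.mem_univ z)
  | succ k ih =>
    obtain ⟨C, hC⟩ := ih hu.circleDeriv
    refine ⟨C, fun n => ?_⟩
    have := hC n
    rw [fourierCoeffCircle_circleDeriv hu, norm_mul, norm_mul, Complex.norm_I, mul_one,
      Complex.norm_intCast] at this
    rwa [pow_succ, mul_assoc]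

lemma RapidDecay.of_norm_le {c d : ℤ → ℂ} (hc : RapidDecay c) (h : ∀ n, ‖d n‖ ≤ ‖c n‖) :
    RapidDecay d := by
  intro k
  obtain ⟨C, hC⟩ := hc k
  exact ⟨C, fun n => (mul_le_mul_of_nonneg_left (h n) (by positivity)).trans (hC n)⟩

lemma RapidDecay.summable {c : ℤ → ℂ} (hc : RapidDecay c) (k : ℕ) :
    Summable (fun n : ℤ => |(n : ℝ)| ^ k * ‖c n‖) := by
  obtain ⟨C, hC⟩ := hc (k + 2)
  have hs : Summable (fun n : ℤ => C * (1 / (n : ℝ) ^ 2)) :=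
    (Real.summable_one_div_int_pow.2 (by norm_num)).mul_left C
  -- The majorant 1 / n ^ 2 takes the value 0 at n = 0, so that index needs a summand of its own.
  have h0 : Summable (fun n : ℤ => if n = 0 then |(n : ℝ)| ^ k * ‖c n‖ else 0) :=
    (hasSum_ite_eq (0 : ℤ) (|((0 : ℤ) : ℝ)| ^ k * ‖c 0‖)).summable.congr
      fun n => by split_ifs with h <;> simp [h]
  refine Summable.of_nonneg_of_le (fun n => by positivity) (fun n => ?_) (hs.add h0)
  rcases eq_or_ne n 0 with rfl | hn
  · simp
  · have hn' : (0 : ℝ) < |(n : ℝ)| := by positivity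
    rw [if_neg hn, add_zero, mul_one_div, le_div_iff₀ (by positivity), ← sq_abs]
    calc _ = |(n : ℝ)| ^ (k + 2) * ‖c n‖ := by ring
      _ ≤ C := hC n

lemma RapidDecay.summable_norm {c : ℤ → ℂ} (hc : RapidDecay c) : Summable (fun n => ‖c n‖) := by
  simpa using hc.summable 0

/-- A smooth function is the sum of its Fourier series. -/
lemma hasSum_fourierCoeffCircle {u : Circle → ℂ} (hu : IsSmooth u) (z : Circle) :
    HasSum (fun n : ℤ => fourierCoeffCircle u n * (z : ℂ) ^ n) (u z) := by
  have : Fact (0 < 2 * Real.pi) := ⟨Real.two_pi_pos⟩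
  have htc : ∀ t : ℝ, AddCircle.toCircle ((t : ℝ) : AddCircle (2 * Real.pi)) = Circle.exp t := by
    intro t
    rw [AddCircle.toCircle_apply_mk, div_self Real.two_pi_pos.ne', one_mul]
  have hfz : ∀ (n : ℤ) (t : ℝ), fourier n ((t : ℝ) : AddCircle (2 * Real.pi)) =
      (Circle.exp t : ℂ) ^ n := by
    intro n t
    rw [fourier_apply, AddCircle.toCircle_zsmul, htc, Circle.coe_zpow]
  let f : C(AddCircle (2 * Real.pi), ℂ) :=
    ⟨fun x => u x.toCircle, hu.continuous.comp AddCircle.continuous_toCircle⟩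
  have hc : ∀ n, fourierCoeff f n = fourierCoeffCircle u n := by
    intro n
    rw [fourierCoeff_eq_intervalIntegral f n 0, fourierCoeffCircle, mean, Complex.real_smul]
    push_cast
    rw [zero_add]
    congr 1
    refine intervalIntegral.integral_congr fun t _ => ?_
    simp only [hfz, smul_eq_mul]
    rw [mul_comm]
    simp [f, htc]
  have hsum : Summable (fourierCoeff f) := by
    rw [funext hc]
    exact (rapidDecay_fourierCoeffCircle hu).summable_norm.of_norm
  have h := has_pointwise_sum_fourier_series_of_summable hsum
    ((Complex.arg z : ℝ) : AddCircle (2 * Real.pi))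
  simp only [hc, hfz, smul_eq_mul, Circle.exp_arg] at h
  simpa [f, htc] using h

/-- Only u is expanded in its Fourier series; integrating term by term against v' produces the
coefficients of v' at -n. -/
lemma hasSum_omega {u v : Circle → ℂ} (hu : IsSmooth u) (hv : IsSmooth v) :
    HasSum (fun n : ℤ => -((n : ℂ) * Complex.I) * fourierCoeffCircle u n *
      fourierCoeffCircle v (-n)) (omega u v) := by
  obtain ⟨C, hC⟩ := (isCompact_univ (X := Circle)).exists_bound_of_continuousOn
    hv.circleDeriv.continuous.continuousOn
  have h := hasSum_mean
    (F := fun n z => fourierCoeffCircle u n * (z : ℂ) ^ n * circleDeriv v z)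
    (G := fun z => u z * circleDeriv v z) (b := fun n => ‖fourierCoeffCircle u n‖ * C)
    (fun n => (continuous_const.mul (isSmooth_zpow n).continuous).mul hv.circleDeriv.continuous)
    (fun n z => ?_) ((rapidDecay_fourierCoeffCircle hu).summable_norm.mul_right C)
    (fun z => (hasSum_fourierCoeffCircle hu z).mul_right _)
  · rw [omega_eq_mean]
    refine h.congr_fun fun n => ?_
    have h2 := fourierCoeffCircle_circleDeriv hv (-n)
    rw [fourierCoeffCircle, neg_neg] at h2
    have h3 : (fun z : Circle => fourierCoeffCircle u n * (z : ℂ) ^ n * circleDeriv v z) =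
        fun z => fourierCoeffCircle u n * (circleDeriv v z * (z : ℂ) ^ n) := by
      funext z; ring
    rw [h3, mean_const_mul, h2]
    push_cast
    ring
  · rw [norm_mul, norm_mul, norm_zpow, Circle.norm_coe, one_zpow, mul_one]
    exact mul_le_mul_of_nonneg_left (hC z (Set.mem_univ z)) (norm_nonneg _)

/-! ### Functions with prescribed Fourier coefficients -/

/-- The sum of a trigonometric series. -/
def trigSeries (c : ℤ → ℂ) (z : Circle) : ℂ := ∑' n : ℤ, c n * (z : ℂ) ^ n

lemma RapidDecay.hasSum_trigSeries {c : ℤ → ℂ} (hc : RapidDecay c) (z : Circle) :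
    HasSum (fun n : ℤ => c n * (z : ℂ) ^ n) (trigSeries c z) := by
  refine Summable.hasSum (Summable.of_norm ?_)
  simpa [Circle.norm_coe] using hc.summable_norm

lemma iteratedDeriv_exp_zpow (n : ℤ) (k : ℕ) :
    iteratedDeriv k (fun t : ℝ => (Circle.exp t : ℂ) ^ n) =
      fun t => ((n : ℂ) * Complex.I) ^ k * (Circle.exp t : ℂ) ^ n := by
  induction k with
  | zero => simp
  | succ k ih =>
    rw [iteratedDeriv_succ, ih]
    funext t
    rw [((hasDerivAt_exp_zpow n t).const_mul _).deriv]
    ring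

lemma RapidDecay.isSmooth_trigSeries {c : ℤ → ℂ} (hc : RapidDecay c) :
    IsSmooth (trigSeries c) := by
  rw [isSmooth_iff_contDiff]
  refine contDiff_tsum (N := ⊤) (f := fun (n : ℤ) (t : ℝ) => c n * (Circle.exp t : ℂ) ^ n)
    (v := fun k n => |(n : ℝ)| ^ k * ‖c n‖)
    (fun n => contDiff_const.mul (isSmooth_zpow n).contDiff) (fun k _ => hc.summable k)
    (fun k n t _ => ?_)
  rw [norm_iteratedFDeriv_eq_norm_iteratedDeriv,
    iteratedDeriv_const_mul_field, iteratedDeriv_exp_zpow]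
  simp [mul_comm]

lemma RapidDecay.fourierCoeffCircle_trigSeries {c : ℤ → ℂ} (hc : RapidDecay c) (m : ℤ) :
    fourierCoeffCircle (trigSeries c) m = c m := by
  have h := hasSum_mean (F := fun n z => c n * (z : ℂ) ^ n * (z : ℂ) ^ (-m))
    (G := fun z => trigSeries c z * (z : ℂ) ^ (-m)) (b := fun n => ‖c n‖)
    (fun n => (continuous_const.mul (isSmooth_zpow n).continuous).mul (isSmooth_zpow _).continuous)
    (fun n z => by simp [Circle.norm_coe]) hc.summable_norm
    (fun z => (hc.hasSum_trigSeries z).mul_right _)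
  have h2 : ∀ n, mean (fun z : Circle => c n * (z : ℂ) ^ n * (z : ℂ) ^ (-m)) =
      if n = m then c m else 0 := by
    intro n
    simp only [mul_assoc]
    rw [mean_const_mul]
    have := fourierCoeffCircle_zpow n m
    rw [fourierCoeffCircle] at this
    rw [this]
    split_ifs with hnm <;> simp [hnm]
  simp only [h2] at h
  exact h.unique (hasSum_ite_eq m (c m))

lemma mean_eq_fourierCoeffCircle_zero (u : Circle → ℂ) : mean u = fourierCoeffCircle u 0 := by
  simp [fourierCoeffCircle]

/-! ### Fourier coefficients on `H` -/

/-- The Fourier coefficients of an element of `H`. -/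
def coef (u : H) (n : ℤ) : ℂ := fourierCoeffCircle u.1 n

lemma coef_add (u v : H) (n : ℤ) : coef (u + v) n = coef u n + coef v n :=
  fourierCoeffCircle_add u.2.1 v.2.1 n

lemma coef_smul (c : ℂ) (u : H) (n : ℤ) : coef (c • u) n = c * coef u n :=
  fourierCoeffCircle_const_mul c u.1 n

lemma coef_zero_right (u : H) : coef u 0 = 0 := by
  rw [coef, ← mean_eq_fourierCoeffCircle_zero, u.2.2]

lemma coef_conjH (u : H) (n : ℤ) : coef (conjH u) n = (starRingEnd ℂ) (coef u (-n)) :=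
  fourierCoeffCircle_conj u.1 n

lemma coef_eHat (m : NZ) (n : ℤ) : coef (eHat m) n = if m.1 = n then 1 else 0 :=
  fourierCoeffCircle_zpow m.1 n

lemma rapidDecay_coef (u : H) : RapidDecay (coef u) := rapidDecay_fourierCoeffCircle u.2.1

lemma ext_coef {u v : H} (h : ∀ n, coef u n = coef v n) : u = v := by
  apply Subtype.ext
  funext z
  have hu := hasSum_fourierCoeffCircle u.2.1 z
  have hv := hasSum_fourierCoeffCircle v.2.1 z
  have h' : ∀ n, fourierCoeffCircle u.1 n = fourierCoeffCircle v.1 n := h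
  simp only [h'] at hu
  exact hu.unique hv

/-- The element of `H` with given rapidly decreasing Fourier coefficients. -/
def ofCoeff (c : ℤ → ℂ) (hc : RapidDecay c) (h0 : c 0 = 0) : H :=
  ⟨trigSeries c, hc.isSmooth_trigSeries, by
    rw [mean_eq_fourierCoeffCircle_zero, hc.fourierCoeffCircle_trigSeries, h0]⟩

lemma coef_ofCoeff (c : ℤ → ℂ) (hc : RapidDecay c) (h0 : c 0 = 0) (n : ℤ) :
    coef (ofCoeff c hc h0) n = c n := hc.fourierCoeffCircle_trigSeries n

lemma rapidDecay_ite (u : H) (p : ℤ → Prop) [DecidablePred p] :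
    RapidDecay (fun n => if p n then coef u n else 0) := by
  refine (rapidDecay_coef u).of_norm_le fun n => ?_
  split_ifs <;> simp

/-- The projection to the positive Fourier modes. -/
def posPart (u : H) : H :=
  ofCoeff (fun n => if 0 < n then coef u n else 0) (rapidDecay_ite u _) (by simp)

/-- The projection to the negative Fourier modes. -/
def negPart (u : H) : H :=
  ofCoeff (fun n => if n < 0 then coef u n else 0) (rapidDecay_ite u _) (by simp)

lemma coef_posPart (u : H) (n : ℤ) : coef (posPart u) n = if 0 < n then coef u n else 0 :=
  coef_ofCoeff _ _ _ n

lemma coef_negPart (u : H) (n : ℤ) : coef (negPart u) n = if n < 0 then coef u n else 0 :=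
  coef_ofCoeff _ _ _ n

lemma posPart_add_negPart (u : H) : posPart u + negPart u = u := by
  refine ext_coef fun n => ?_
  rw [coef_add, coef_posPart, coef_negPart]
  rcases lt_trichotomy n 0 with h | h | h
  · simp [h, h.le]
  · simp [h, coef_zero_right]
  · simp [h, h.le]

lemma conjH_conjH (u : H) : conjH (conjH u) = u := by
  refine ext_coef fun n => ?_
  rw [coef_conjH, coef_conjH]
  simp

/-! ### The form `ω` in Fourier coefficients -/

lemma hasSum_omega_coef (u v : H) :
    HasSum (fun n : ℤ => -((n : ℂ) * Complex.I) * coef u n * coef v (-n)) (omega u.1 v.1) :=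
  hasSum_omega u.2.1 v.2.1

lemma omega_eHat_right (u : H) (n : NZ) :
    omega u.1 (eHat n).1 = (n.1 : ℂ) * Complex.I * coef u (-n.1) := omega_zpow n.1

lemma omega_eHat_left (n : NZ) (v : H) :
    omega (eHat n).1 v.1 = -((n.1 : ℂ) * Complex.I * coef v (-n.1)) := by
  rw [omega_antisymm (eHat n).2.1 v.2.1, omega_eHat_right]

/-- The form pairs the mode n with the mode -n, so the ω-transpose of one projection is the other.
-/
lemma omega_negPart_left (u v : H) : omega (negPart u).1 v.1 = omega u.1 (posPart v).1 := by
  refine (hasSum_omega_coef (negPart u) v).unique ((hasSum_omega_coef u (posPart v)).congr_fun ?_)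
  intro n
  rw [coef_negPart, coef_posPart]
  by_cases h : n < 0 <;> simp [h]

/-- The square of the norm `‖·‖_ω`, as a sum over the Fourier coefficients. -/
def energy (u : H) : ℝ := ∑' n : ℤ, |(n : ℝ)| * ‖coef u n‖ ^ 2

lemma summable_energy (u : H) : Summable (fun n : ℤ => |(n : ℝ)| * ‖coef u n‖ ^ 2) := by
  obtain ⟨C, hC⟩ := rapidDecay_coef u 0
  refine Summable.of_nonneg_of_le (fun n => by positivity) (fun n => ?_)
    (((rapidDecay_coef u).summable 1).mul_right C)
  have := hC n
  rw [pow_zero, one_mul] at this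
  rw [pow_one, pow_two, ← mul_assoc]
  exact mul_le_mul_of_nonneg_left this (by positivity)

lemma energy_nonneg (u : H) : 0 ≤ energy u := tsum_nonneg fun n => by positivity

lemma energy_le_of_norm_coef_le {u v : H} (h : ∀ n, ‖coef u n‖ ≤ ‖coef v n‖) :
    energy u ≤ energy v := by
  refine (summable_energy u).tsum_le_tsum (fun n => ?_) (summable_energy v)
  have := h n
  gcongr

lemma energy_posPart_le (u : H) : energy (posPart u) ≤ energy u :=
  energy_le_of_norm_coef_le fun n => by rw [coef_posPart]; split_ifs <;> simp

lemma energy_negPart_le (u : H) : energy (negPart u) ≤ energy u :=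
  energy_le_of_norm_coef_le fun n => by rw [coef_negPart]; split_ifs <;> simp

lemma energy_conjH (u : H) : energy (conjH u) = energy u := by
  rw [energy, energy, ← (Equiv.neg ℤ).tsum_eq]
  refine tsum_congr fun n => ?_
  simp [coef_conjH]

lemma energy_add_le (u v : H) : energy (u + v) ≤ 2 * energy u + 2 * energy v := by
  rw [energy, energy, energy, ← tsum_mul_left, ← tsum_mul_left,
    ← ((summable_energy u).mul_left 2).tsum_add ((summable_energy v).mul_left 2)]
  refine (summable_energy _).tsum_le_tsum (fun n => ?_)
    (((summable_energy u).mul_left 2).add ((summable_energy v).mul_left 2))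
  rw [coef_add]
  have h1 : ‖coef u n + coef v n‖ ^ 2 ≤ 2 * ‖coef u n‖ ^ 2 + 2 * ‖coef v n‖ ^ 2 := by
    have h2 := norm_add_le (coef u n) (coef v n)
    have h3 := norm_nonneg (coef u n + coef v n)
    nlinarith [sq_nonneg (‖coef u n‖ - ‖coef v n‖)]
  calc _ ≤ |(n : ℝ)| * (2 * ‖coef u n‖ ^ 2 + 2 * ‖coef v n‖ ^ 2) := by gcongr
    _ = _ := by ring

lemma hilbertJ_eq_trigSeries (u : Circle → ℂ) :
    hilbertJ u = trigSeries (fun n => Complex.I * (n.sign : ℂ) * fourierCoeffCircle u n) := rfl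

lemma rapidDecay_hilbertJ {u : Circle → ℂ} (hu : IsSmooth u) :
    RapidDecay (fun n => Complex.I * (n.sign : ℂ) * fourierCoeffCircle u n) := by
  refine (rapidDecay_fourierCoeffCircle hu).of_norm_le fun n => ?_
  rw [norm_mul, norm_mul, Complex.norm_I, one_mul]
  have h : ‖((n.sign : ℤ) : ℂ)‖ ≤ 1 := by
    rw [Complex.norm_intCast]
    rcases lt_trichotomy n 0 with h | h | h
    · simp [Int.sign_eq_neg_one_of_neg h]
    · simp [h]
    · simp [Int.sign_eq_one_of_pos h]
  exact mul_le_of_le_one_left (norm_nonneg _) h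

/-- The multiplier i sgn of J absorbs the factor i and the sign of n in ω, leaving n sgn(n) = |n|.
-/
lemma hasSum_innerOmega (u v : H) :
    HasSum (fun n : ℤ => ((|(n : ℝ)| : ℝ) : ℂ) * coef u n * (starRingEnd ℂ) (coef v n))
      (innerOmega u v) := by
  have hd := rapidDecay_hilbertJ (conjH v).2.1
  have h := (hasSum_omega u.2.1 hd.isSmooth_trigSeries).neg
  rw [innerOmega, hilbertJ_eq_trigSeries]
  refine h.congr_fun fun n => ?_
  rw [hd.fourierCoeffCircle_trigSeries]
  have h2 := coef_conjH v (-n)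
  rw [neg_neg] at h2
  rw [← coef, ← coef, h2]
  have h3 : ((|(n : ℝ)| : ℝ) : ℂ) = (n : ℂ) * (n.sign : ℂ) := by
    rw [← Int.cast_abs, ← Int.sign_mul_self_eq_abs]
    push_cast
    ring
  rw [h3, Int.sign_neg]
  push_cast
  linear_combination (n : ℂ) * n.sign * coef u n * (starRingEnd ℂ) (coef v n) * Complex.I_sq

lemma innerOmega_self (u : H) : innerOmega u u = (energy u : ℂ) := by
  refine (hasSum_innerOmega u u).unique ?_
  refine (Complex.hasSum_ofReal.2 (summable_energy u).hasSum).congr_fun fun n => ?_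
  rw [mul_assoc, Complex.mul_conj, Complex.normSq_eq_norm_sq]
  push_cast
  ring

lemma normOmega_eq (u : H) : normOmega u = Real.sqrt (energy u) := by
  rw [normOmega, innerOmega_self, Complex.ofReal_re]

lemma innerOmega_eHat (u : H) (m : NZ) :
    innerOmega u (eHat m) = ((|(m.1 : ℝ)| : ℝ) : ℂ) * coef u m.1 := by
  refine (hasSum_innerOmega u (eHat m)).unique ?_
  refine (hasSum_ite_eq m.1 (((|(m.1 : ℝ)| : ℝ) : ℂ) * coef u m.1)).congr_fun fun n => ?_
  rw [coef_eHat]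
  by_cases h : n = m.1
  · simp [h]
  · simp [h, Ne.symm h]

lemma innerOmega_smul_right (c : ℂ) (u v : H) :
    innerOmega u (c • v) = (starRingEnd ℂ) c * innerOmega u v := by
  refine (hasSum_innerOmega u (c • v)).unique ?_
  refine ((hasSum_innerOmega u v).mul_left _).congr_fun fun n => ?_
  rw [coef_smul, map_mul]
  ring

/-- The factor of `e^{inθ}` in `ẽ_n`. -/
def tildeScale (n : NZ) : ℂ :=
  if 0 < n.1 then 1 / (Real.sqrt (n.1 : ℝ) : ℂ) else 1 / (Complex.I * (Real.sqrt |(n.1 : ℝ)| : ℂ))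

lemma eTilde_eq (n : NZ) : eTilde n = tildeScale n • eHat n := rfl

lemma norm_tildeScale_sq (n : NZ) : ‖tildeScale n‖ ^ 2 = 1 / |(n.1 : ℝ)| := by
  rw [tildeScale]
  split_ifs with h
  · have h' : (0 : ℝ) ≤ n.1 := by exact_mod_cast h.le
    rw [norm_div, norm_one, Complex.norm_real, Real.norm_eq_abs, div_pow, sq_abs,
      Real.sq_sqrt h', one_pow, abs_of_nonneg h']
  · rw [norm_div, norm_one, norm_mul, Complex.norm_I, one_mul, Complex.norm_real,
      Real.norm_eq_abs, div_pow, sq_abs, Real.sq_sqrt (abs_nonneg _), one_pow]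

lemma matrixEntry_eq (A : H →ₗ[ℂ] H) (m n : NZ) :
    matrixEntry A m n = (starRingEnd ℂ) (tildeScale m) * tildeScale n * ((|(m.1 : ℝ)| : ℝ) : ℂ) *
      coef (A (eHat n)) m.1 := by
  rw [matrixEntry, eTilde_eq, eTilde_eq, innerOmega_smul_right, innerOmega_eHat, map_smul,
    coef_smul]
  ring

lemma abs_cast_pos (n : NZ) : (0 : ℝ) < |(n.1 : ℝ)| := abs_pos.2 (by exact_mod_cast n.2)

lemma norm_matrixEntry_sq (A : H →ₗ[ℂ] H) (m n : NZ) :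
    ‖matrixEntry A m n‖ ^ 2 = |(m.1 : ℝ)| / |(n.1 : ℝ)| * ‖coef (A (eHat n)) m.1‖ ^ 2 := by
  have hm := abs_cast_pos m
  have hn := abs_cast_pos n
  rw [matrixEntry_eq, norm_mul, norm_mul, norm_mul, mul_pow, mul_pow, mul_pow, RCLike.norm_conj,
    norm_tildeScale_sq, norm_tildeScale_sq, Complex.norm_real, Real.norm_eq_abs, abs_abs]
  field_simp

/-! ### Boundedness in terms of the energy -/

lemma isBoundedOp_iff (A : H →ₗ[ℂ] H) :
    IsBoundedOp A ↔ ∃ C : ℝ, 0 ≤ C ∧ ∀ u, energy (A u) ≤ C * energy u := by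
  constructor
  · rintro ⟨C, hC⟩
    refine ⟨C ^ 2, sq_nonneg C, fun u => ?_⟩
    have h := pow_le_pow_left₀ (Real.sqrt_nonneg _) ((normOmega_eq (A u)) ▸ hC u) 2
    rwa [normOmega_eq, mul_pow, Real.sq_sqrt (energy_nonneg _),
      Real.sq_sqrt (energy_nonneg _)] at h
  · rintro ⟨C, hC0, hC⟩
    refine ⟨Real.sqrt C, fun u => ?_⟩
    rw [normOmega_eq, normOmega_eq, ← Real.sqrt_mul hC0]
    exact Real.sqrt_le_sqrt (hC u)

/-- The positive indices. -/
abbrev PosIdx : Type := {m : NZ // 0 < m.1}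

/-- The negative indices. -/
abbrev NegIdx : Type := {n : NZ // n.1 < 0}

lemma posIdx_injective : Function.Injective (fun m : PosIdx => m.1.1) :=
  Subtype.val_injective.comp Subtype.val_injective

lemma negIdx_injective : Function.Injective (fun m : NegIdx => m.1.1) :=
  Subtype.val_injective.comp Subtype.val_injective

lemma summable_energy_pos (u : H) :
    Summable (fun m : PosIdx => |(m.1.1 : ℝ)| * ‖coef u m.1.1‖ ^ 2) :=
  (summable_energy u).comp_injective posIdx_injective

lemma summable_energy_neg (u : H) :
    Summable (fun m : NegIdx => |(m.1.1 : ℝ)| * ‖coef u m.1.1‖ ^ 2) :=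
  (summable_energy u).comp_injective negIdx_injective

lemma tsum_neg_le_energy (u : H) :
    ∑' m : NegIdx, |(m.1.1 : ℝ)| * ‖coef u m.1.1‖ ^ 2 ≤ energy u :=
  tsum_comp_le_tsum_of_inj (summable_energy u) (fun n => by positivity) negIdx_injective

lemma energy_posPart (u : H) :
    energy (posPart u) = ∑' m : PosIdx, |(m.1.1 : ℝ)| * ‖coef u m.1.1‖ ^ 2 := by
  rw [energy, ← posIdx_injective.tsum_eq]
  · refine tsum_congr fun m => ?_
    rw [coef_posPart, if_pos m.2]
  · intro n hn
    by_cases h : 0 < n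
    · exact ⟨⟨⟨n, h.ne'⟩, h⟩, rfl⟩
    · simp [coef_posPart, h] at hn

lemma hasSum_omega_conjH (u : H) :
    HasSum (fun n : ℤ => (n : ℝ) * ‖coef u n‖ ^ 2) (-(omega u.1 (conjH u).1).im) := by
  have h := (Complex.hasSum_im (hasSum_omega_coef u (conjH u))).neg
  refine h.congr_fun fun n => ?_
  rw [coef_conjH, neg_neg, mul_assoc, Complex.mul_conj, Complex.normSq_eq_norm_sq, ← neg_mul,
    mul_right_comm, Complex.mul_I_im, ← Complex.ofReal_intCast, ← Complex.ofReal_neg,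
    ← Complex.ofReal_mul, Complex.ofReal_re]
  ring

/-- Termwise, |n| = -n + 2 max(n, 0). The ω-term is invariant under real operators preserving ω, so
a norm bound for such an operator reduces to its positive output. -/
lemma energy_eq (u : H) :
    energy u = (omega u.1 (conjH u).1).im + 2 * energy (posPart u) := by
  have h1 := (hasSum_omega_conjH u).neg.add ((summable_energy (posPart u)).hasSum.mul_left 2)
  rw [neg_neg] at h1
  refine (h1.congr_fun fun n => ?_).tsum_eq
  rw [coef_posPart]
  rcases lt_or_ge 0 n with h | h
  · have : (0 : ℝ) < n := by exact_mod_cast h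
    rw [if_pos h, abs_of_pos this]
    ring
  · have : (n : ℝ) ≤ 0 := by exact_mod_cast h
    rw [if_neg (not_lt.2 h), abs_of_nonpos this]
    simp

lemma IsRealOp.map_conjH {A : H →ₗ[ℂ] H} (hA : IsRealOp A) (u : H) :
    A (conjH u) = conjH (A u) := by
  rw [hA (conjH u), conjH_conjH]

/-! ### Operators preserving `ω` -/

section Preserve

variable {A B : H ≃ₗ[ℂ] H}

lemma PreservesOmega.symm (hA : PreservesOmega A.toLinearMap) :
    PreservesOmega A.symm.toLinearMap := by
  intro u v
  have := hA (A.symm u) (A.symm v)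
  simpa using this.symm

lemma PreservesOmega.omega_left (hA : PreservesOmega A.toLinearMap) (u v : H) :
    omega (A u).1 v.1 = omega u.1 (A.symm v).1 := by
  have := hA u (A.symm v)
  simpa using this

/-- The index `-n`. -/
def negIdx (n : NZ) : NZ := ⟨-n.1, neg_ne_zero.2 n.2⟩

lemma negIdx_negIdx (n : NZ) : negIdx (negIdx n) = n := Subtype.ext (neg_neg _)

/-- A coefficient of A u is a pairing of u with a fixed element of `H`. This makes the coefficient
functionals of A accessible before any boundedness of A is known. -/
lemma PreservesOmega.coef_symm (hA : PreservesOmega A.toLinearMap) (u : H) (m : NZ) :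
    omega u.1 (A.symm (eHat (negIdx m))).1 = -((m.1 : ℂ) * Complex.I * coef (A u) m.1) := by
  rw [← hA.omega_left, omega_eHat_right]
  simp [negIdx]

/-- The matrix of the inverse. -/
lemma PreservesOmega.mul_coef_symm (hA : PreservesOmega A.toLinearMap) (m n : NZ) :
    (m.1 : ℂ) * coef (A.symm (eHat n)) m.1 = n.1 * coef (A (eHat (negIdx m))) (-n.1) := by
  have h := hA.coef_symm (eHat (negIdx m)) (negIdx n)
  rw [negIdx_negIdx, omega_eHat_left] at h
  simp only [negIdx] at h ⊢
  push_cast at h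
  rw [neg_neg] at h
  have h2 : Complex.I * ((m.1 : ℂ) * coef (A.symm (eHat n)) m.1) =
      Complex.I * (n.1 * coef (A (eHat ⟨-m.1, neg_ne_zero.2 m.2⟩)) (-n.1)) := by
    linear_combination h
  exact mul_left_cancel₀ Complex.I_ne_zero h2

/-- The expansion of ω(u, A⁻¹ê₋ₘ) already converges, so the matrix acts on coefficients without
continuity of A. -/
lemma PreservesOmega.hasSum_coef (hA : PreservesOmega A.toLinearMap) (u : H) (m : NZ) :
    HasSum (fun n : NZ => coef u n.1 * coef (A (eHat n)) m.1) (coef (A u) m.1) := by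
  have hm : -((m.1 : ℂ) * Complex.I) ≠ 0 := by
    simpa using m.2
  have h := hasSum_omega_coef u (A.symm (eHat (negIdx m)))
  rw [hA.coef_symm] at h
  have h2 : HasSum (fun n : NZ => -((n.1 : ℂ) * Complex.I) * coef u n.1 *
      coef (A.symm (eHat (negIdx m))) (-n.1)) (-((m.1 : ℂ) * Complex.I * coef (A u) m.1)) := by
    refine (Function.Injective.hasSum_iff (Subtype.val_injective (p := fun n : ℤ => n ≠ 0))
      (fun n hn => ?_)).2 h
    have : n = 0 := by simpa using hn
    simp [this]
  have h3 := h2.mul_left (-((m.1 : ℂ) * Complex.I))⁻¹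
  rw [← neg_mul (_ * _), inv_mul_cancel_left₀ hm] at h3
  refine h3.congr_fun fun n => ?_
  have h4 := hA.coef_symm (eHat n) m
  rw [omega_eHat_left] at h4
  rw [eq_inv_mul_iff_mul_eq₀ hm]
  linear_combination -coef u n.1 * h4

lemma summable_block_iff (A : H →ₗ[ℂ] H) : OffDiagonalHilbertSchmidt A ↔
    Summable (fun p : PosIdx × NegIdx =>
      |(p.1.1.1 : ℝ)| / |(p.2.1.1 : ℝ)| * ‖coef (A (eHat p.2.1)) p.1.1.1‖ ^ 2) := by
  simp only [OffDiagonalHilbertSchmidt, norm_matrixEntry_sq]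

/-- The involution `(m, n) ↦ (-n, -m)`. -/
def swapNeg : PosIdx × NegIdx ≃ PosIdx × NegIdx where
  toFun p := (⟨negIdx p.2.1, Int.neg_pos_of_neg p.2.2⟩, ⟨negIdx p.1.1, Int.neg_neg_of_pos p.1.2⟩)
  invFun p := (⟨negIdx p.2.1, Int.neg_pos_of_neg p.2.2⟩, ⟨negIdx p.1.1, Int.neg_neg_of_pos p.1.2⟩)
  left_inv p := by simp [negIdx_negIdx]
  right_inv p := by simp [negIdx_negIdx]

/-- The hypothesis is the relation that ω-duality gives between two transposed coefficients; the
conclusion compares their squared normalized entries. -/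
lemma weighted_norm_sq_eq {m n : ℝ} (hm : m ≠ 0) (hn : n ≠ 0) {a b : ℝ}
    (h : |m| * a = |n| * b) : |m| / |n| * a ^ 2 = |n| / |m| * b ^ 2 := by
  have hm' := abs_pos.2 hm
  have hn' := abs_pos.2 hn
  have h2 : a = |n| * b / |m| := by field_simp; linarith
  rw [h2]
  field_simp

/-- By `mul_coef_symm` the block of A⁻¹ is, in absolute value, the block of A reindexed by
`swapNeg`, which maps the positive-negative index pairs to themselves. -/
lemma OffDiagonalHilbertSchmidt.symm (hA : PreservesOmega A.toLinearMap)
    (h : OffDiagonalHilbertSchmidt A.toLinearMap) :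
    OffDiagonalHilbertSchmidt A.symm.toLinearMap := by
  rw [summable_block_iff] at h ⊢
  rw [← swapNeg.summable_iff] at h
  refine h.congr fun p => ?_
  obtain ⟨⟨m, hm⟩, ⟨n, hn⟩⟩ := p
  have h1 := congrArg norm (hA.mul_coef_symm m n)
  rw [norm_mul, norm_mul, Complex.norm_intCast, Complex.norm_intCast] at h1
  simp only [Function.comp_apply, swapNeg, Equiv.coe_fn_mk]
  have h2 := weighted_norm_sq_eq (by exact_mod_cast m.2) (by exact_mod_cast n.2) h1
  simp only [LinearEquiv.coe_coe] at h2 ⊢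
  rw [h2]
  simp [negIdx]

lemma tsum_mul_sq_le {ι : Type*} {f g : ι → ℝ} (hf : ∀ i, 0 ≤ f i) (hg : ∀ i, 0 ≤ g i)
    (hf2 : Summable fun i => f i ^ 2) (hg2 : Summable fun i => g i ^ 2) :
    (Summable fun i => f i * g i) ∧
      (∑' i, f i * g i) ^ 2 ≤ (∑' i, f i ^ 2) * ∑' i, g i ^ 2 := by
  have h := Real.summable_and_inner_le_Lp_mul_Lq_tsum_of_nonneg (p := 2) (q := 2)
    Real.HolderConjugate.two_two hf hg (by simpa using hf2) (by simpa using hg2)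
  refine ⟨h.1, ?_⟩
  have h2 := h.2
  simp only [Real.rpow_two, ← Real.sqrt_eq_rpow] at h2
  rw [← Real.sqrt_mul (tsum_nonneg fun i => sq_nonneg _)] at h2
  calc _ ≤ Real.sqrt ((∑' i, f i ^ 2) * ∑' i, g i ^ 2) ^ 2 :=
        pow_le_pow_left₀ (tsum_nonneg fun i => mul_nonneg (hf i) (hg i)) h2 2
    _ = _ := Real.sq_sqrt (mul_nonneg (tsum_nonneg fun i => sq_nonneg _)
        (tsum_nonneg fun i => sq_nonneg _))

/-- A Hilbert–Schmidt off-diagonal block is bounded on the negative part. -/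
lemma energy_posPart_map_negPart_le (hA : PreservesOmega A.toLinearMap)
    (h : OffDiagonalHilbertSchmidt A.toLinearMap) :
    ∃ S : ℝ, 0 ≤ S ∧ ∀ u : H, energy (posPart (A (negPart u))) ≤ S * energy (negPart u) := by
  rw [summable_block_iff] at h
  have hrow := h.prod_factor
  have hsum := h.prod
  refine ⟨∑' (m : PosIdx) (n : NegIdx),
    |(m.1.1 : ℝ)| / |(n.1.1 : ℝ)| * ‖coef (A (eHat n.1)) m.1.1‖ ^ 2,
    tsum_nonneg fun m => tsum_nonneg fun n => by positivity, fun u => ?_⟩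
  rw [energy_posPart, mul_comm, ← tsum_mul_left]
  refine (summable_energy_pos _).tsum_le_tsum (fun m => ?_) (hsum.mul_left _)
  have hs : HasSum (fun n : NegIdx => coef (negPart u) n.1.1 * coef (A (eHat n.1)) m.1.1)
      (coef (A (negPart u)) m.1.1) := by
    refine (Function.Injective.hasSum_iff
      (Subtype.val_injective (p := fun n : NZ => n.1 < 0)) (fun n hn => ?_)).2
      (hA.hasSum_coef (negPart u) m.1)
    have hn' : ¬ n.1 < 0 := by simpa using hn
    rw [coef_negPart, if_neg hn', zero_mul]
  have hm : (0 : ℝ) < |(m.1.1 : ℝ)| := abs_cast_pos m.1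
  -- Cauchy–Schwarz with the weight √|n| split off: f² gives the energy of the negative part, and g²
  -- gives the m-th row of the block divided by |m|.
  let f : NegIdx → ℝ := fun n => Real.sqrt |(n.1.1 : ℝ)| * ‖coef (negPart u) n.1.1‖
  let g : NegIdx → ℝ := fun n => 1 / Real.sqrt |(n.1.1 : ℝ)| * ‖coef (A (eHat n.1)) m.1.1‖
  have hf2 : ∀ n, f n ^ 2 = |(n.1.1 : ℝ)| * ‖coef (negPart u) n.1.1‖ ^ 2 := fun n => by
    simp only [f, mul_pow, Real.sq_sqrt (abs_nonneg _)]
  have hg2 : ∀ n, g n ^ 2 = |(m.1.1 : ℝ)|⁻¹ * (|(m.1.1 : ℝ)| / |(n.1.1 : ℝ)| *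
      ‖coef (A (eHat n.1)) m.1.1‖ ^ 2) := fun n => by
    simp only [g, mul_pow, div_pow, Real.sq_sqrt (abs_nonneg _)]
    field_simp
  have hcs := tsum_mul_sq_le (f := f) (g := g) (fun n => by positivity) (fun n => by positivity)
    (by simpa only [hf2] using summable_energy_neg (negPart u))
    (by simpa only [hg2, LinearEquiv.coe_coe] using (hrow m).mul_left |(m.1.1 : ℝ)|⁻¹)
  have hfg : ∀ n, f n * g n = ‖coef (negPart u) n.1.1 * coef (A (eHat n.1)) m.1.1‖ := fun n => by
    have : 0 < Real.sqrt |(n.1.1 : ℝ)| := Real.sqrt_pos.2 (abs_cast_pos n.1)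
    simp only [f, g, norm_mul]
    field_simp
  simp only [hfg, hf2, hg2] at hcs
  have hb : ‖coef (A (negPart u)) m.1.1‖ ≤
      ∑' n : NegIdx, ‖coef (negPart u) n.1.1 * coef (A (eHat n.1)) m.1.1‖ := by
    rw [← hs.tsum_eq]
    exact norm_tsum_le_tsum_norm hcs.1
  have hb2 := (pow_le_pow_left₀ (norm_nonneg _) hb 2).trans hcs.2
  rw [tsum_mul_left] at hb2
  have hb3 : |(m.1.1 : ℝ)| * ‖coef (A (negPart u)) m.1.1‖ ^ 2 ≤
      (∑' n : NegIdx, |(n.1.1 : ℝ)| * ‖coef (negPart u) n.1.1‖ ^ 2) *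
      ∑' n : NegIdx, |(m.1.1 : ℝ)| / |(n.1.1 : ℝ)| * ‖coef (A (eHat n.1)) m.1.1‖ ^ 2 := by
    refine (mul_le_mul_of_nonneg_left hb2 hm.le).trans_eq ?_
    field_simp
  exact hb3.trans (mul_le_mul_of_nonneg_right (tsum_neg_le_energy _)
    (tsum_nonneg fun n => by positivity))

/-- A real automorphism preserving `ω` with Hilbert–Schmidt off-diagonal block is bounded. -/
lemma exists_energy_le (hA : PreservesOmega A.toLinearMap) (hr : IsRealOp A.toLinearMap)
    (h : OffDiagonalHilbertSchmidt A.toLinearMap) :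
    ∃ C : ℝ, 0 ≤ C ∧ ∀ u, energy (A u) ≤ C * energy u := by
  obtain ⟨S, hS, hSu⟩ := energy_posPart_map_negPart_le hA h
  have hconj : ∀ u, A (conjH u) = conjH (A u) := hr.map_conjH
  -- For w purely negative, Im ω(w, w̄) is the whole energy of w, and A preserves it; only the
  -- positive part of A w can add to the norm.
  have hneg : ∀ u, energy (A (negPart u)) ≤ (1 + 2 * S) * energy (negPart u) := by
    intro u
    have h1 := energy_eq (A (negPart u))
    have h2 := energy_eq (negPart u)
    have h3 : posPart (negPart u) = 0 := by
      refine ext_coef fun n => ?_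
      have h0 : coef (0 : H) n = 0 := by simpa using coef_smul 0 0 n
      rw [coef_posPart, coef_negPart, h0]
      split_ifs with ha hb
      · omega
      · rfl
      · rfl
    have h4 : energy 0 = 0 := by
      have h0 : ∀ n, coef (0 : H) n = 0 := fun n => by simpa using coef_smul 0 0 n
      simp [energy, h0]
    rw [h3, h4] at h2
    rw [← hconj] at h1
    have h5 : omega (A (negPart u)).1 (A (conjH (negPart u))).1 = _ := hA _ _
    rw [h5] at h1
    have := hSu u
    linarith
  -- Conjugation exchanges positive and negative modes, preserves the energy and commutes with A.
  have hpos : ∀ u, energy (A (posPart u)) ≤ (1 + 2 * S) * energy (posPart u) := by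
    intro u
    have h1 : conjH (posPart u) = negPart (conjH u) := by
      refine ext_coef fun n => ?_
      rw [coef_conjH, coef_posPart, coef_negPart, coef_conjH]
      by_cases hn : n < 0 <;> simp [hn]
    have h2 := hneg (conjH u)
    rwa [← h1, hconj, energy_conjH, energy_conjH] at h2
  refine ⟨4 * (1 + 2 * S), by positivity, fun u => ?_⟩
  have h1 := energy_add_le (A (posPart u)) (A (negPart u))
  rw [← map_add, posPart_add_negPart] at h1
  have h2 := hpos u
  have h3 := hneg u
  have h4 := mul_le_mul_of_nonneg_left (energy_posPart_le u) (by positivity : 0 ≤ 1 + 2 * S)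
  have h5 := mul_le_mul_of_nonneg_left (energy_negPart_le u) (by positivity : 0 ≤ 1 + 2 * S)
  linarith

/-- The composition of a Hilbert–Schmidt block and a bounded operator is Hilbert–Schmidt. -/
lemma summable_bounded_comp_block {A B : H →ₗ[ℂ] H} (hA : IsBoundedOp A)
    (hB : OffDiagonalHilbertSchmidt B) :
    Summable (fun p : PosIdx × NegIdx =>
      |(p.1.1.1 : ℝ)| / |(p.2.1.1 : ℝ)| *
        ‖coef (A (posPart (B (eHat p.2.1)))) p.1.1.1‖ ^ 2) := by
  obtain ⟨C, hC0, hC⟩ := (isBoundedOp_iff A).1 hA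
  -- With n as the outer index, the inner sum over m is the energy of the positive part of the image
  -- of ê_n, to which the bound on A applies.
  rw [summable_block_iff, ← (Equiv.prodComm NegIdx PosIdx).summable_iff] at hB
  rw [← (Equiv.prodComm NegIdx PosIdx).summable_iff]
  have hdiv : ∀ (n : NegIdx) (v : H) (m : PosIdx),
      |(m.1.1 : ℝ)| / |(n.1.1 : ℝ)| * ‖coef v m.1.1‖ ^ 2 =
      |(n.1.1 : ℝ)|⁻¹ * (|(m.1.1 : ℝ)| * ‖coef v m.1.1‖ ^ 2) := fun n v m => by ring
  rw [summable_prod_of_nonneg (fun p => by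
    simp only [Function.comp_apply, Pi.zero_apply]; positivity)]
  have hB2 := hB.prod
  simp only [Function.comp_apply, Equiv.prodComm_apply, Prod.swap_prod_mk, hdiv,
    tsum_mul_left] at hB2 ⊢
  refine ⟨fun n => (summable_energy_pos _).mul_left _, ?_⟩
  refine Summable.of_nonneg_of_le (fun n => mul_nonneg (by positivity)
    (tsum_nonneg fun m => by positivity)) (fun n => ?_) (hB2.mul_left C)
  rw [← energy_posPart, ← energy_posPart]
  have h1 := (energy_posPart_le _).trans (hC (posPart (B (eHat n.1))))
  have h2 : 0 ≤ |(n.1.1 : ℝ)|⁻¹ := by positivity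
  nlinarith [mul_le_mul_of_nonneg_left h1 h2]

/-- Split B ê_n into positive and negative parts. The positive part gives a bounded operator after
the block of B. For the negative part, moving A and then B across ω turns the entry into one of B⁻¹
π⁺ A⁻¹ at (-n, -m), a bounded operator after the block of A⁻¹. -/
lemma OffDiagonalHilbertSchmidt.comp (hA : PreservesOmega A.toLinearMap)
    (hB : PreservesOmega B.toLinearMap) (hAb : IsBoundedOp A.toLinearMap)
    (hBb : IsBoundedOp B.symm.toLinearMap) (hAs : OffDiagonalHilbertSchmidt A.toLinearMap)
    (hBs : OffDiagonalHilbertSchmidt B.toLinearMap) :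
    OffDiagonalHilbertSchmidt (A * B).toLinearMap := by
  have h1 := summable_bounded_comp_block hAb hBs
  have h2 := summable_bounded_comp_block hBb (hAs.symm hA)
  rw [← swapNeg.summable_iff] at h2
  rw [summable_block_iff]
  refine Summable.of_nonneg_of_le (fun p => by positivity) (fun p => ?_)
    ((h1.mul_left 2).add (h2.mul_left 2))
  obtain ⟨⟨m, hm⟩, ⟨n, hn⟩⟩ := p
  have hm' := abs_cast_pos m
  have hn' := abs_cast_pos n
  simp only [Function.comp_apply, swapNeg, Equiv.coe_fn_mk, LinearEquiv.coe_coe,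
    LinearEquiv.mul_apply]
  have hsplit : coef (A (B (eHat n))) m.1 =
      coef (A (posPart (B (eHat n)))) m.1 + coef (A (negPart (B (eHat n)))) m.1 := by
    rw [← coef_add, ← map_add, posPart_add_negPart]
  have hdual : (m.1 : ℂ) * coef (A (negPart (B (eHat n)))) m.1 =
      n.1 * coef (B.symm (posPart (A.symm (eHat (negIdx m))))) (negIdx n).1 := by
    have e1 := hA.coef_symm (negPart (B (eHat n))) m
    rw [omega_negPart_left, hB.omega_left, omega_eHat_left, neg_inj] at e1
    refine mul_left_cancel₀ Complex.I_ne_zero ?_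
    simp only [negIdx] at e1 ⊢
    linear_combination -e1
  have hdual' := congrArg norm hdual
  rw [norm_mul, norm_mul, Complex.norm_intCast, Complex.norm_intCast] at hdual'
  have h3 := weighted_norm_sq_eq (by exact_mod_cast m.2) (by exact_mod_cast n.2) hdual'
  have habs : |(((negIdx n).1 : ℤ) : ℝ)| = |(n.1 : ℝ)| := by simp [negIdx]
  have habs' : |(((negIdx m).1 : ℤ) : ℝ)| = |(m.1 : ℝ)| := by simp [negIdx]
  rw [hsplit, habs, habs', ← h3, ← mul_add, ← mul_add, ← mul_assoc, mul_comm (2 : ℝ), mul_assoc]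
  refine mul_le_mul_of_nonneg_left ?_ (by positivity)
  set a := coef (A (posPart (B (eHat n)))) m.1
  set b := coef (A (negPart (B (eHat n)))) m.1
  have h4 := norm_add_le a b
  have h5 := norm_nonneg (a + b)
  nlinarith [sq_nonneg (‖a‖ - ‖b‖)]

lemma IsRealOp.symm (hA : IsRealOp A.toLinearMap) : IsRealOp A.symm.toLinearMap := by
  intro u
  apply A.injective
  have h := hA.map_conjH (A.symm (conjH u))
  simp only [LinearEquiv.coe_coe, LinearEquiv.apply_symm_apply] at h ⊢
  rw [h, conjH_conjH]

lemma mem_SpInf_iff : A ∈ SpInf ↔ IsRealOp A.toLinearMap ∧ PreservesOmega A.toLinearMap ∧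
    OffDiagonalHilbertSchmidt A.toLinearMap := by
  refine ⟨fun h => h.2.2, fun ⟨hr, ho, hs⟩ => ⟨?_, ?_, hr, ho, hs⟩⟩
  · exact (isBoundedOp_iff _).2 (exists_energy_le ho hr hs)
  · exact (isBoundedOp_iff _).2 (exists_energy_le ho.symm hr.symm (hs.symm ho))

end Preserve

/-! ### The group Sp(∞). -/

lemma offDiagonalHilbertSchmidt_one :
    OffDiagonalHilbertSchmidt (1 : H ≃ₗ[ℂ] H).toLinearMap := by
  rw [summable_block_iff]
  refine summable_zero.congr fun p => ?_
  obtain ⟨⟨m, hm⟩, ⟨n, hn⟩⟩ := p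
  have h : n.1 ≠ m.1 := by omega
  simp [coef_eHat, h]

/-- `Sp(∞)` as a group. -/
def spSubgroup : Subgroup (H ≃ₗ[ℂ] H) where
  carrier := SpInf
  one_mem' := mem_SpInf_iff.2
    ⟨fun u => (conjH_conjH u).symm, fun _ _ => rfl, offDiagonalHilbertSchmidt_one⟩
  mul_mem' := by
    rintro A B ⟨hA, hA', hAr, hAo, hAs⟩ ⟨hB, hB', hBr, hBo, hBs⟩
    refine mem_SpInf_iff.2 ⟨fun u => ?_, fun u v => ?_, hAs.comp hAo hBo hA hB' hBs⟩
    · have h1 := hAr.map_conjH (B u)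
      have h2 := hBr.map_conjH u
      simp only [LinearEquiv.coe_coe, LinearEquiv.mul_apply] at h1 h2 ⊢
      rw [h2, h1, conjH_conjH]
    · exact (hAo (B u) (B v)).trans (hBo u v)
  inv_mem' := by
    rintro A ⟨-, -, hAr, hAo, hAs⟩
    exact mem_SpInf_iff.2 ⟨hAr.symm, hAo.symm, hAs.symm hAo⟩

/-! ### Lifts of diffeomorphisms of the circle -/

lemma contDiff_lift {φ : Circle → Circle} (hφ : ContMDiff (𝓡 1) (𝓡 1) ∞ φ) {f : ℝ → ℝ}
    (hc : Continuous f) (hf : ∀ t, φ (Circle.exp t) = Circle.exp (f t)) : ContDiff ℝ ∞ f := by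
  refine contDiff_of_circleExp hc ?_
  simp only [← hf]
  exact IsSmooth.contDiff (u := fun z => (φ z : ℂ)) (ContMDiff.comp isSmooth_coe hφ)

/-- The increment over a period is 2πk with k ≥ 1 by monotonicity. If f s = f t + 2π, injectivity of
φ forces s - t to be a positive multiple of 2π, so s ≥ t + 2π and k ≤ 1. -/
lemma orderIso_lift_add_two_pi {φ : Circle → Circle} (hφ : Function.Injective φ) {f : ℝ ≃o ℝ}
    (hf : ∀ t, φ (Circle.exp t) = Circle.exp (f t)) (t : ℝ) :
    f (t + 2 * Real.pi) = f t + 2 * Real.pi := by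
  have hpi := Real.pi_pos
  have h1 : Circle.exp (f (t + 2 * Real.pi)) = Circle.exp (f t) := by
    rw [← hf, ← hf, Circle.periodic_exp]
  obtain ⟨k, hk⟩ := Circle.exp_eq_exp.1 h1
  have hk0 : 0 < k := by
    have hlt : f t < f (t + 2 * Real.pi) := f.strictMono (by linarith)
    rw [hk] at hlt
    by_contra hneg
    have : (k : ℝ) ≤ 0 := by exact_mod_cast not_lt.1 hneg
    nlinarith
  obtain ⟨s, hs⟩ := f.surjective (f t + 2 * Real.pi)
  have h2 : Circle.exp s = Circle.exp t := by
    apply hφ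
    rw [hf, hf, hs, Circle.periodic_exp]
  obtain ⟨j, hj⟩ := Circle.exp_eq_exp.1 h2
  have hts : t < s := f.lt_iff_lt.1 (by linarith)
  have hj0 : (1 : ℝ) ≤ j := by
    have : 0 < j := by
      by_contra hneg
      have : (j : ℝ) ≤ 0 := by exact_mod_cast not_lt.1 hneg
      nlinarith
    exact_mod_cast this
  have h3 : f (t + 2 * Real.pi) ≤ f s := f.monotone (by nlinarith)
  have hk1 : (1 : ℝ) ≤ k := by exact_mod_cast hk0
  nlinarith

/-- The inverse of an orientation preserving diffeomorphism of the circle has a smooth lift to the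
line with derivative bounded below. -/
lemma exists_smooth_lift (φ : DiffS1) : ∃ g : ℝ → ℝ,
    (∀ t, φ.1.symm (Circle.exp t) = Circle.exp (g t)) ∧ ContDiff ℝ ∞ g ∧
    (∀ t, g (t + 2 * Real.pi) = g t + 2 * Real.pi) ∧ ∃ c : ℝ, 0 < c ∧ ∀ t, c ≤ deriv g t := by
  obtain ⟨hφ, hφ', f, hf⟩ := φ.2
  have hg : ∀ t, φ.1.symm (Circle.exp t) = Circle.exp (f.symm t) := fun t => by
    rw [Equiv.symm_apply_eq, hf, OrderIso.apply_symm_apply]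
  have hgs : ContDiff ℝ ∞ f.symm := contDiff_lift hφ' f.symm.continuous hg
  have hfs : ContDiff ℝ ∞ f := contDiff_lift hφ f.continuous hf
  have hper : ∀ t, f.symm (t + 2 * Real.pi) = f.symm t + 2 * Real.pi :=
    orderIso_lift_add_two_pi φ.1.symm.injective hg
  have hpos : ∀ t, 0 < deriv f.symm t := by
    intro t
    have h1 : 0 ≤ deriv f.symm t := f.symm.monotone.deriv_nonneg
    refine lt_of_le_of_ne h1 fun h0 => ?_
    have hd1 : HasDerivAt f.symm (deriv f.symm t) t :=
      ((contDiff_infty_iff_deriv.1 hgs).1 t).hasDerivAt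
    have hd2 : HasDerivAt f (deriv f (f.symm t)) (f.symm t) :=
      ((contDiff_infty_iff_deriv.1 hfs).1 _).hasDerivAt
    have h2 := hd2.comp t hd1
    -- A zero of the derivative would contradict the chain rule, since the inverse lift is smooth
    -- too.
    have h3 : (f ∘ f.symm : ℝ → ℝ) = id := by
      funext x
      simp
    rw [h3, ← h0, mul_zero] at h2
    exact zero_ne_one (h2.unique (hasDerivAt_id t))
  have hcont : Continuous (deriv f.symm) := (contDiff_infty_iff_deriv.1 hgs).2.continuous
  have hdper : Function.Periodic (deriv f.symm) (2 * Real.pi) := by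
    intro t
    have h := deriv_comp_add_const f.symm (2 * Real.pi) t
    simp only [hper, deriv_add_const] at h
    exact h.symm
  obtain ⟨t₀, -, ht₀⟩ := (isCompact_Icc (a := (0 : ℝ)) (b := 2 * Real.pi)).exists_isMinOn
    ⟨0, by simp [Real.pi_pos.le]⟩ hcont.continuousOn
  refine ⟨f.symm, hg, hgs, hper, deriv f.symm t₀, hpos t₀, fun t => ?_⟩
  obtain ⟨s, hs, hst⟩ := hdper.exists_mem_Ico₀ Real.two_pi_pos t
  rw [hst]
  exact ht₀ ⟨hs.1, hs.2.le⟩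

/-! ### The action of diffeomorphisms on `H` -/

lemma IsSmooth.comp_diff {u : Circle → ℂ} (hu : IsSmooth u) (φ : DiffS1) :
    IsSmooth (fun z => u (φ.1.symm z)) :=
  ContMDiff.comp hu φ.2.2.1

/-- The operator `Φ(φ)` on `H`. -/
def diffLin (φ : DiffS1) : H →ₗ[ℂ] H where
  toFun u := ⟨diffAct φ u.1, (u.2.1.comp_diff φ).sub (isSmooth_const _), by
    have h := mean_sub (u.2.1.comp_diff φ) (isSmooth_const (mean fun w => u.1 (φ.1.symm w)))
    rwa [mean_const, sub_self] at h⟩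
  map_add' u v := by
    apply Subtype.ext
    funext z
    have h := mean_add (u.2.1.comp_diff φ) (v.2.1.comp_diff φ)
    simp only [diffAct, Submodule.coe_add, Pi.add_apply]
    rw [h]
    ring
  map_smul' c u := by
    apply Subtype.ext
    funext z
    have h := mean_const_mul c (fun w => u.1 (φ.1.symm w))
    simp only [diffAct, Submodule.coe_smul, Pi.smul_apply, smul_eq_mul, RingHom.id_apply]
    rw [h]
    ring

lemma diffLin_coe (φ : DiffS1) (u : H) : (diffLin φ u).1 = diffAct φ u.1 := rfl

lemma diffLin_one : diffLin 1 = LinearMap.id := by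
  refine LinearMap.ext fun u => Subtype.ext (funext fun z => ?_)
  change u.1 z - mean u.1 = u.1 z
  rw [u.2.2, sub_zero]

lemma diffLin_mul (φ ψ : DiffS1) : diffLin (φ * ψ) = diffLin φ ∘ₗ diffLin ψ := by
  refine LinearMap.ext fun u => Subtype.ext (funext fun z => ?_)
  have h := mean_sub ((u.2.1.comp_diff ψ).comp_diff φ)
    (isSmooth_const (mean (fun w => u.1 (ψ.1.symm w))))
  rw [mean_const] at h
  change u.1 (ψ.1.symm (φ.1.symm z)) - mean (fun w => u.1 (ψ.1.symm (φ.1.symm w))) =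
    (u.1 (ψ.1.symm (φ.1.symm z)) - mean (fun w => u.1 (ψ.1.symm w))) -
      mean (fun w => u.1 (ψ.1.symm (φ.1.symm w)) - mean (fun w => u.1 (ψ.1.symm w)))
  rw [h]
  ring

/-- The operator `Φ(φ)` as an automorphism of `H`. -/
def diffEquiv (φ : DiffS1) : H ≃ₗ[ℂ] H :=
  LinearEquiv.ofLinearMap (diffLin φ) (diffLin φ⁻¹)
    (by rw [← diffLin_mul, mul_inv_cancel, diffLin_one])
    (by rw [← diffLin_mul, inv_mul_cancel, diffLin_one])

lemma isRealOp_diffLin (φ : DiffS1) : IsRealOp (diffLin φ) := by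
  intro u
  apply Subtype.ext
  funext z
  change u.1 (φ.1.symm z) - mean (fun w => u.1 (φ.1.symm w)) =
    (starRingEnd ℂ) ((starRingEnd ℂ) (u.1 (φ.1.symm z)) -
      mean (fun w => (starRingEnd ℂ) (u.1 (φ.1.symm w))))
  rw [mean_conj]
  simp

/-- Substitute s = g(t): the integrand is periodic, so the interval from g(0) to g(0) + 2π may be
replaced by [0, 2π]. The subtracted mean contributes nothing because v' integrates to zero. -/
lemma preservesOmega_diffLin (φ : DiffS1) : PreservesOmega (diffLin φ) := by
  obtain ⟨g, hg, hgs, hper, -⟩ := exists_smooth_lift φ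
  intro u v
  simp only [omega, diffLin_coe]
  congr 1
  set a := mean (fun w => u.1 (φ.1.symm w)) with ha
  have hgd : ∀ t, HasDerivAt g (deriv g t) t :=
    fun t => ((contDiff_infty_iff_deriv.1 hgs).1 t).hasDerivAt
  have hgc : Continuous (deriv g) := (contDiff_infty_iff_deriv.1 hgs).2.continuous
  have hd : ∀ t, dTheta (diffAct φ v.1) t = deriv g t • dTheta v.1 (g t) := by
    intro t
    have h := (v.2.1.hasDerivAt (g t)).scomp t (hgd t)
    simp only [dTheta, diffAct, deriv_sub_const_fun, hg]
    exact h.deriv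
  have hcont : Continuous (fun s : ℝ => (u.1 (Circle.exp s) - a) * dTheta v.1 s) :=
    ((u.2.1.contDiff.continuous).sub continuous_const).mul v.2.1.continuous_dTheta
  have hsub := intervalIntegral.integral_deriv_smul_comp (a := 0) (b := 2 * Real.pi)
    (fun t _ => hgd t) hgc.continuousOn hcont
  have hg2 : g (2 * Real.pi) = g 0 + 2 * Real.pi := by simpa using hper 0
  have hp : Function.Periodic (fun s : ℝ => (u.1 (Circle.exp s) - a) * dTheta v.1 s)
      (2 * Real.pi) := fun s => by
    simp only [Circle.periodic_exp s, dTheta_periodic v.1 s]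
  have h0 : ∫ s in (0 : ℝ)..(2 * Real.pi), dTheta v.1 s = 0 := by
    rw [intervalIntegral.integral_eq_sub_of_hasDerivAt (fun t _ => v.2.1.hasDerivAt t)
      (v.2.1.continuous_dTheta.intervalIntegrable _ _)]
    simp
  calc _ = ∫ t in (0 : ℝ)..(2 * Real.pi), deriv g t •
        ((fun s : ℝ => (u.1 (Circle.exp s) - a) * dTheta v.1 s) ∘ g) t := by
        refine intervalIntegral.integral_congr fun t _ => ?_
        simp only [hd, diffAct, hg, Function.comp_apply, mul_smul_comm, ← ha]
    _ = ∫ s in (0 : ℝ)..(0 + 2 * Real.pi), (u.1 (Circle.exp s) - a) * dTheta v.1 s := by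
        rw [hsub, hg2]
        exact hp.intervalIntegral_add_eq _ _
    _ = _ := by
        simp only [sub_mul]
        rw [zero_add, intervalIntegral.integral_sub, intervalIntegral.integral_const_mul, h0,
          mul_zero, sub_zero]
        · exact (u.2.1.contDiff.continuous.mul v.2.1.continuous_dTheta).intervalIntegrable _ _
        · exact (continuous_const.mul v.2.1.continuous_dTheta).intervalIntegrable _ _

/-! ### Decay of the off-diagonal block -/

/-- Integration by parts against an oscillating factor with phase derivative `-h`. -/
lemma integral_phase_by_parts {E : ℝ → ℂ} {h q q' : ℝ → ℝ} {a b : ℝ}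
    (hE : ∀ t, HasDerivAt E (-(Complex.I * (h t : ℂ)) * E t) t) (hh : Continuous h)
    (hq : ∀ t, HasDerivAt q (q' t) t) (hq' : Continuous q') (hEab : E a = E b)
    (hqab : q a = q b) :
    ∫ t in a..b, ((q t * h t : ℝ) : ℂ) * E t =
      -Complex.I * ∫ t in a..b, ((q' t : ℝ) : ℂ) * E t := by
  have hEc : Continuous E := continuous_iff_continuousAt.2 fun t => (hE t).continuousAt
  have h1 := intervalIntegral.integral_mul_deriv_eq_deriv_mul (a := a) (b := b)
    (u := fun t => ((q t : ℝ) : ℂ)) (u' := fun t => ((q' t : ℝ) : ℂ)) (v := E)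
    (v' := fun t => -(Complex.I * (h t : ℂ)) * E t) (fun t _ => (hq t).ofReal_comp)
    (fun t _ => hE t) (by apply Continuous.intervalIntegrable; fun_prop)
    (by apply Continuous.intervalIntegrable; fun_prop)
  rw [hEab, hqab, sub_self, zero_sub] at h1
  have h2 : ∫ t in a..b, ((q t : ℝ) : ℂ) * (-(Complex.I * (h t : ℂ)) * E t) =
      -Complex.I * ∫ t in a..b, ((q t * h t : ℝ) : ℂ) * E t := by
    rw [← intervalIntegral.integral_const_mul]
    refine intervalIntegral.integral_congr fun t _ => ?_
    simp only [Complex.ofReal_mul]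
    ring
  rw [h2] at h1
  linear_combination Complex.I * h1 + (∫ t in a..b, ((q t * h t : ℝ) : ℂ) * E t) * Complex.I_sq

/-- Two integrations by parts in an oscillatory integral without stationary points. -/
lemma integral_phase_eq {E : ℝ → ℂ} {h h₁ h₂ : ℝ → ℝ} {a b : ℝ}
    (hE : ∀ t, HasDerivAt E (-(Complex.I * (h t : ℂ)) * E t) t)
    (hh : ∀ t, HasDerivAt h (h₁ t) t) (hh₁ : ∀ t, HasDerivAt h₁ (h₂ t) t) (hh₂ : Continuous h₂)
    (hpos : ∀ t, 0 < h t) (hEab : E a = E b) (hab : h a = h b) (hab₁ : h₁ a = h₁ b) :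
    ∫ t in a..b, E t =
      -∫ t in a..b, ((-h₂ t / h t ^ 3 + 3 * h₁ t ^ 2 / h t ^ 4 : ℝ) : ℂ) * E t := by
  have hhc : Continuous h := continuous_iff_continuousAt.2 fun t => (hh t).continuousAt
  have hhc₁ : Continuous h₁ := continuous_iff_continuousAt.2 fun t => (hh₁ t).continuousAt
  have hne : ∀ t, h t ≠ 0 := fun t => (hpos t).ne'
  -- The first integration by parts uses q = 1/h, so that q h = 1; the second uses q = (1/h)'/h.
  have hq1 : ∀ t, HasDerivAt (fun t => (h t)⁻¹) (-h₁ t / h t ^ 2) t := fun t => (hh t).inv (hne t)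
  have hq2 : ∀ t, HasDerivAt (fun t => -h₁ t / h t ^ 3)
      (-h₂ t / h t ^ 3 + 3 * h₁ t ^ 2 / h t ^ 4) t := by
    intro t
    have := (hh₁ t).neg.div ((hh t).pow 3) (pow_ne_zero 3 (hne t))
    refine this.congr_deriv ?_
    have := hne t
    simp only [Pi.pow_apply, Pi.neg_apply]
    field_simp
    push_cast
    ring
  have hc1 : Continuous (fun t => -h₁ t / h t ^ 2) :=
    hhc₁.neg.div (hhc.pow 2) fun t => pow_ne_zero 2 (hne t)
  have hc2 : Continuous (fun t => -h₂ t / h t ^ 3 + 3 * h₁ t ^ 2 / h t ^ 4) :=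
    (hh₂.neg.div (hhc.pow 3) fun t => pow_ne_zero 3 (hne t)).add
      ((continuous_const.mul (hhc₁.pow 2)).div (hhc.pow 4) fun t => pow_ne_zero 4 (hne t))
  have e1 := integral_phase_by_parts hE hhc hq1 hc1 hEab (by simp only [hab])
  have e2 := integral_phase_by_parts hE hhc hq2 hc2 hEab (by simp only [hab, hab₁])
  have s1 : ∀ t, (h t)⁻¹ * h t = 1 := fun t => inv_mul_cancel₀ (hne t)
  have s2 : ∀ t, -h₁ t / h t ^ 3 * h t = -h₁ t / h t ^ 2 := fun t => by
    have := hne t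
    field_simp
  simp only [s1, Complex.ofReal_one, one_mul] at e1
  simp only [s2] at e2
  rw [e1, e2, ← mul_assoc, neg_mul_neg, Complex.I_mul_I, neg_one_mul]

lemma coef_diffLin_eHat (φ : DiffS1) (n : NZ) (m : NZ) :
    coef (diffLin φ (eHat n)) m.1 =
      mean (fun z => (φ.1.symm z : ℂ) ^ n.1 * (z : ℂ) ^ (-m.1)) := by
  set a := mean (fun w => (eHat n).1 (φ.1.symm w))
  have h1 : (fun z => diffAct φ (eHat n).1 z * (z : ℂ) ^ (-m.1)) =
      fun z : Circle => (φ.1.symm z : ℂ) ^ n.1 * (z : ℂ) ^ (-m.1) - a * (z : ℂ) ^ (-m.1) := by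
    funext z
    rw [← sub_mul]
    rfl
  have h2 := mean_sub (((isSmooth_zpow n.1).comp_diff φ).mul (isSmooth_zpow (-m.1)))
    ((isSmooth_const a).mul (isSmooth_zpow (-m.1)))
  rw [coef, diffLin_coe, fourierCoeffCircle, h1, h2, mean_const_mul,
    mean_zpow (neg_ne_zero.2 m.2), mul_zero, sub_zero]

/-- Off-diagonal Fourier coefficients of a diffeomorphism decay quadratically. -/
lemma exists_coef_diffLin_le (φ : DiffS1) : ∃ C : ℝ, 0 ≤ C ∧ ∀ (m : PosIdx) (n : NegIdx),
    ‖coef (diffLin φ (eHat n.1)) m.1.1‖ ≤ C / (|(m.1.1 : ℝ)| + |(n.1.1 : ℝ)|) ^ 2 := by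
  obtain ⟨g, hg, hgs, hper, c, hc, hcg⟩ := exists_smooth_lift φ
  have hs1 := contDiff_infty_iff_deriv.1 hgs
  have hs2 := contDiff_infty_iff_deriv.1 hs1.2
  have hs3 := contDiff_infty_iff_deriv.1 hs2.2
  have hd1 : ∀ t, HasDerivAt g (deriv g t) t := fun t => (hs1.1 t).hasDerivAt
  have hd2 : ∀ t, HasDerivAt (deriv g) (deriv (deriv g) t) t := fun t => (hs2.1 t).hasDerivAt
  have hd3 : ∀ t, HasDerivAt (deriv (deriv g)) (deriv (deriv (deriv g)) t) t :=
    fun t => (hs3.1 t).hasDerivAt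
  have hp1 : Function.Periodic (deriv g) (2 * Real.pi) := fun t => by
    have h := deriv_comp_add_const g (2 * Real.pi) t
    simp only [hper, deriv_add_const] at h
    exact h.symm
  have hp2 : Function.Periodic (deriv (deriv g)) (2 * Real.pi) := fun t => by
    have h := deriv_comp_add_const (deriv g) (2 * Real.pi) t
    simp only [hp1 _] at h
    exact h.symm
  obtain ⟨K₁, hK₁⟩ :=
    (isCompact_Icc (a := (0 : ℝ)) (b := 2 * Real.pi)).exists_bound_of_continuousOn
    hs2.2.continuous.continuousOn
  obtain ⟨K₂, hK₂⟩ :=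
    (isCompact_Icc (a := (0 : ℝ)) (b := 2 * Real.pi)).exists_bound_of_continuousOn
    hs3.2.continuous.continuousOn
  have hpi := Real.pi_pos
  have h0mem : (0 : ℝ) ∈ Set.Icc 0 (2 * Real.pi) := ⟨le_rfl, by positivity⟩
  have hK₁0 : 0 ≤ K₁ := (norm_nonneg _).trans (hK₁ 0 h0mem)
  have hK₂0 : 0 ≤ K₂ := (norm_nonneg _).trans (hK₂ 0 h0mem)
  -- This d bounds both g' and 1, whence |n| g' + m ≥ d (|n| + m).
  set d := min c 1 with hd
  have hd0 : 0 < d := lt_min hc one_pos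
  -- With N = m + |n|, the integrand left by `integral_phase_eq` has |h₁| ≤ N K₁, |h₂| ≤ N K₂ and h
  -- ≥ d N; both of its terms are then of order N⁻².
  refine ⟨K₂ / d ^ 3 + 3 * K₁ ^ 2 / d ^ 4, by positivity, fun m n => ?_⟩
  have hm : (0 : ℝ) < m.1.1 := by exact_mod_cast m.2
  have hn : (n.1.1 : ℝ) < 0 := by exact_mod_cast n.2
  rw [coef_diffLin_eHat, abs_of_pos hm, abs_of_neg hn]
  set p : ℝ := -(n.1.1 : ℝ) with hp
  set N : ℝ := m.1.1 + p with hN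
  have hp0 : 0 < p := by linarith
  have hN0 : 0 < N := by linarith
  have hpN : p ≤ N := by linarith
  let E : ℝ → ℂ := fun t => (Circle.exp (g t) : ℂ) ^ n.1.1 * (Circle.exp t : ℂ) ^ (-m.1.1)
  have hE : ∀ t, HasDerivAt E
      (-(Complex.I * ((p * deriv g t + m.1.1 : ℝ) : ℂ)) * E t) t := by
    intro t
    have h1 := (hasDerivAt_exp_zpow n.1.1 (g t)).scomp t (hd1 t)
    refine (h1.mul (hasDerivAt_exp_zpow (-m.1.1) t)).congr_deriv ?_
    simp only [E, Function.comp_apply, Complex.real_smul, hp]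
    push_cast
    ring
  have hEper : E 0 = E (2 * Real.pi) := by
    have h1 : Circle.exp (2 * Real.pi) = Circle.exp 0 := by simp
    simp only [E, ← hg, h1]
  have hh : ∀ t, HasDerivAt (fun t => p * deriv g t + m.1.1) (p * deriv (deriv g) t) t :=
    fun t => ((hd2 t).const_mul p).add_const _
  have hh₁ : ∀ t, HasDerivAt (fun t => p * deriv (deriv g) t)
      (p * deriv (deriv (deriv g)) t) t := fun t => (hd3 t).const_mul p
  have hlow : ∀ t, d * N ≤ p * deriv g t + m.1.1 := by
    intro t
    have h1 : d ≤ deriv g t := (min_le_left _ _).trans (hcg t)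
    have h2 : d ≤ 1 := min_le_right _ _
    nlinarith [mul_le_mul_of_nonneg_left h1 hp0.le, mul_le_mul_of_nonneg_right h2 hm.le]
  have hpos : ∀ t, 0 < p * deriv g t + m.1.1 := fun t =>
    (by positivity : 0 < d * N).trans_le (hlow t)
  have hp1' : deriv g 0 = deriv g (2 * Real.pi) := by simpa using (hp1 0).symm
  have hp2' : deriv (deriv g) 0 = deriv (deriv g) (2 * Real.pi) := by simpa using (hp2 0).symm
  have key := integral_phase_eq hE hh hh₁ (continuous_const.mul hs3.2.continuous) hpos hEper
    (by simp only [hp1']) (by simp only [hp2'])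
  have hmean : mean (fun z => (φ.1.symm z : ℂ) ^ n.1.1 * (z : ℂ) ^ (-m.1.1)) =
      (1 / (2 * (Real.pi : ℂ))) * ∫ t in (0 : ℝ)..(2 * Real.pi), E t := by
    simp only [mean, hg, E]
  have hEn : ∀ t, ‖E t‖ = 1 := fun t => by
    simp only [E, norm_mul, norm_zpow, Circle.norm_coe, one_zpow, mul_one]
  have hbd : ∀ t ∈ Set.uIoc 0 (2 * Real.pi),
      ‖(((-(p * deriv (deriv (deriv g)) t) / (p * deriv g t + m.1.1) ^ 3 +
        3 * (p * deriv (deriv g) t) ^ 2 / (p * deriv g t + m.1.1) ^ 4 : ℝ)) : ℂ) * E t‖ ≤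
      (K₂ / d ^ 3 + 3 * K₁ ^ 2 / d ^ 4) / N ^ 2 := by
    intro t ht
    rw [Set.uIoc_of_le (by positivity)] at ht
    have ht' : t ∈ Set.Icc 0 (2 * Real.pi) := ⟨ht.1.le, ht.2⟩
    have b1 := hK₁ t ht'
    have b2 := hK₂ t ht'
    rw [Real.norm_eq_abs] at b1 b2
    rw [norm_mul, hEn, mul_one, Complex.norm_real, Real.norm_eq_abs]
    refine (abs_add_le _ _).trans ?_
    have hl := hlow t
    have hdN : 0 < d * N := by positivity
    have hx := hpos t
    rw [abs_div, abs_div, abs_neg, abs_mul, abs_of_pos hp0, abs_mul, abs_of_pos (pow_pos hx 3),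
      abs_of_pos (pow_pos hx 4), abs_pow, abs_mul, abs_of_pos hp0,
      abs_of_pos (by norm_num : (0 : ℝ) < 3)]
    calc _ ≤ N * K₂ / (d * N) ^ 3 + 3 * (N * K₁) ^ 2 / (d * N) ^ 4 := by gcongr
      _ = _ := by field_simp
  have hI := intervalIntegral.norm_integral_le_of_norm_le_const hbd
  rw [sub_zero, abs_of_pos (by positivity)] at hI
  rw [hmean, key, norm_mul, norm_neg]
  have h2 : ‖(1 / (2 * (Real.pi : ℂ)))‖ = 1 / (2 * Real.pi) := by simp [abs_of_pos hpi]
  rw [h2, one_div_mul_eq_div, div_le_iff₀ (by positivity)]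
  exact hI

lemma summable_inv_sq_comp {ι : Type*} {i : ι → ℤ} (hi : Function.Injective i) :
    Summable (fun x => 1 / ((i x : ℝ)) ^ 2) :=
  (Real.summable_one_div_int_pow.2 (by norm_num : 1 < 2)).comp_injective hi

/-- With x = m and y = |n|, the weighted square is at most C² x / (y (x + y)⁴), and x³y ≤ (x + y)⁴
reduces this to C² / (x²y²), a product of two convergent series. -/
lemma offDiagonalHilbertSchmidt_diffLin (φ : DiffS1) :
    OffDiagonalHilbertSchmidt (diffLin φ) := by
  obtain ⟨C, hC0, hC⟩ := exists_coef_diffLin_le φ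
  rw [summable_block_iff]
  have hs := ((summable_inv_sq_comp posIdx_injective).mul_of_nonneg
    (summable_inv_sq_comp negIdx_injective) (fun _ => by positivity)
    (fun _ => by positivity)).mul_left (C ^ 2)
  refine Summable.of_nonneg_of_le (fun p => by positivity) (fun p => ?_) hs
  obtain ⟨m, n⟩ := p
  have h := hC m n
  have hm := abs_cast_pos m.1
  have hn := abs_cast_pos n.1
  simp only
  rw [← sq_abs (m.1.1 : ℝ), ← sq_abs (n.1.1 : ℝ)]
  set x := |(m.1.1 : ℝ)|
  set y := |(n.1.1 : ℝ)|
  have h1 : x ^ 3 * y ≤ (x + y) ^ 4 := by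
    have : (x + y) ^ 4 = x ^ 3 * y + (x ^ 4 + 3 * x ^ 3 * y + 6 * x ^ 2 * y ^ 2 +
      4 * x * y ^ 3 + y ^ 4) := by ring
    rw [this]
    have : 0 ≤ x ^ 4 + 3 * x ^ 3 * y + 6 * x ^ 2 * y ^ 2 + 4 * x * y ^ 3 + y ^ 4 := by positivity
    linarith
  calc _ ≤ x / y * (C / (x + y) ^ 2) ^ 2 := by gcongr
    _ = x / y * (C ^ 2 / (x + y) ^ 4) := by rw [div_pow, ← pow_mul]
    _ ≤ x / y * (C ^ 2 / (x ^ 3 * y)) := by gcongr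
    _ = _ := by field_simp

/-! ### The homomorphism Φ, its circles and its injectivity. -/

lemma diffEquiv_mem (φ : DiffS1) : diffEquiv φ ∈ spSubgroup :=
  mem_SpInf_iff.2 ⟨isRealOp_diffLin φ, preservesOmega_diffLin φ,
    offDiagonalHilbertSchmidt_diffLin φ⟩

/-- The homomorphism `Φ : Diff(S¹) → Sp(∞)`. -/
def diffHom : DiffS1 →* spSubgroup where
  toFun φ := ⟨diffEquiv φ, diffEquiv_mem φ⟩
  map_one' := Subtype.ext (LinearEquiv.toLinearMap_injective diffLin_one)
  map_mul' φ ψ := Subtype.ext (LinearEquiv.toLinearMap_injective (diffLin_mul φ ψ))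

/-- Composing e^{iθ} with φ⁻¹ only reparametrizes the unit circle, and subtracting the mean
translates it. -/
lemma range_diffAct (φ : DiffS1) :
    ∃ c : ℂ, Set.range (diffLin φ (eHat idxOne)).1 = Metric.sphere c 1 := by
  set a := mean (fun w => (eHat idxOne).1 (φ.1.symm w))
  have h : ∀ z, (diffLin φ (eHat idxOne)).1 z = (φ.1.symm z : ℂ) - a := fun z => by
    change (φ.1.symm z : ℂ) ^ (1 : ℤ) - a = _
    rw [zpow_one]
  refine ⟨-a, Set.ext fun w => ?_⟩
  rw [mem_sphere_iff_norm, sub_neg_eq_add, Set.mem_range]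
  constructor
  · rintro ⟨z, rfl⟩
    rw [h, sub_add_cancel, Circle.norm_coe]
  · intro hw
    obtain ⟨y, hy⟩ : ∃ y : Circle, (y : ℂ) = w + a :=
      ⟨⟨w + a, mem_sphere_zero_iff_norm.2 hw⟩, rfl⟩
    refine ⟨φ.1 y, ?_⟩
    rw [h, Equiv.symm_apply_apply, hy, add_sub_cancel_right]

/-- Equality on e^{iθ} alone makes φ⁻¹ and ψ⁻¹ differ by a constant a - b. Were it nonzero, the
point where ψ⁻¹ takes the value (a - b)/|a - b| would give φ⁻¹ modulus 1 + |a - b|. -/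
lemma diffHom_injective : Function.Injective diffHom := by
  intro φ ψ h
  have h1 : ∀ z, diffAct φ (eHat idxOne).1 z = diffAct ψ (eHat idxOne).1 z := fun z =>
    congrArg (fun A : spSubgroup => ((A : H ≃ₗ[ℂ] H) (eHat idxOne)).1 z) h
  set a := mean (fun w => (eHat idxOne).1 (φ.1.symm w))
  set b := mean (fun w => (eHat idxOne).1 (ψ.1.symm w))
  have h2 : ∀ z, (φ.1.symm z : ℂ) - a = (ψ.1.symm z : ℂ) - b := fun z => by
    have := h1 z
    change (φ.1.symm z : ℂ) ^ (1 : ℤ) - a = (ψ.1.symm z : ℂ) ^ (1 : ℤ) - b at this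
    simpa using this
  have hab : a = b := by
    by_contra hne
    have hd : a - b ≠ 0 := sub_ne_zero.2 hne
    have hd' : 0 < ‖a - b‖ := norm_pos_iff.2 hd
    let w : Circle := ⟨(a - b) / (‖a - b‖ : ℂ), mem_sphere_zero_iff_norm.2 (by
      rw [norm_div, Complex.norm_real, norm_norm, div_self hd'.ne'])⟩
    have h3 := h2 (ψ.1 w)
    rw [Equiv.symm_apply_apply] at h3
    have h4 : (φ.1.symm (ψ.1 w) : ℂ) = (1 + (‖a - b‖ : ℂ)) * w := by
      have hw : (w : ℂ) * (‖a - b‖ : ℂ) = a - b := by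
        have : (‖a - b‖ : ℂ) ≠ 0 := by exact_mod_cast hd'.ne'
        exact div_mul_cancel₀ _ this
      linear_combination h3 - hw
    have h5 := congrArg norm h4
    rw [norm_mul, Circle.norm_coe, Circle.norm_coe, mul_one] at h5
    have h6 : ‖(1 + (‖a - b‖ : ℂ))‖ = 1 + ‖a - b‖ := by
      rw [← Complex.ofReal_one, ← Complex.ofReal_add, Complex.norm_real, Real.norm_eq_abs,
        abs_of_pos (by positivity)]
    linarith
  have h3 : φ.1.symm = ψ.1.symm := by
    ext z
    have := h2 z
    rw [hab] at this
    exact sub_left_injective this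
  exact Subtype.ext (Equiv.symm_bijective.injective h3)

/-! ### A symplectic operator not induced by a diffeomorphism -/

lemma sqrt_two_mul_self : (Real.sqrt 2 : ℂ) * (Real.sqrt 2 : ℂ) = 2 := by
  exact_mod_cast Real.mul_self_sqrt (by norm_num : (0 : ℝ) ≤ 2)

/-- The operator with matrix `(√2, s; s, √2)` on the span of `e^{iθ}`, `e^{-iθ}`, and the identity
on the other Fourier modes. -/
def hyperbolicLin (s : ℂ) : H →ₗ[ℂ] H where
  toFun u := u + (((Real.sqrt 2 : ℂ) - 1) * coef u 1 + s * coef u (-1)) • eHat idxOne +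
    (((Real.sqrt 2 : ℂ) - 1) * coef u (-1) + s * coef u 1) • eHat idxNegOne
  map_add' u v := by
    simp only [coef_add]
    module
  map_smul' c u := by
    simp only [coef_smul, RingHom.id_apply]
    module

lemma coef_hyperbolicLin (s : ℂ) (u : H) (n : ℤ) : coef (hyperbolicLin s u) n =
    if n = 1 then (Real.sqrt 2 : ℂ) * coef u 1 + s * coef u (-1)
    else if n = -1 then (Real.sqrt 2 : ℂ) * coef u (-1) + s * coef u 1 else coef u n := by
  have h : coef (hyperbolicLin s u) n = coef u n +
      (((Real.sqrt 2 : ℂ) - 1) * coef u 1 + s * coef u (-1)) * (if (1 : ℤ) = n then 1 else 0) +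
      (((Real.sqrt 2 : ℂ) - 1) * coef u (-1) + s * coef u 1) *
        (if (-1 : ℤ) = n then 1 else 0) := by
    change coef (u + _ + _) n = _
    rw [coef_add, coef_add, coef_smul, coef_smul, coef_eHat, coef_eHat]
    rfl
  rw [h]
  rcases eq_or_ne n 1 with rfl | h1
  · norm_num
    ring
  rcases eq_or_ne n (-1) with rfl | h2
  · norm_num
    ring
  · simp [h1, h2, Ne.symm h1, Ne.symm h2]

/-- The 2 × 2 matrix has determinant 2 - s² = 1, so inversion just changes the sign of s. -/
lemma hyperbolicLin_comp {s : ℂ} (hs : s * s = 1) :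
    hyperbolicLin s ∘ₗ hyperbolicLin (-s) = LinearMap.id := by
  refine LinearMap.ext fun u => ext_coef fun n => ?_
  have h2 := sqrt_two_mul_self
  simp only [LinearMap.comp_apply, LinearMap.id_apply, coef_hyperbolicLin]
  rcases eq_or_ne n 1 with rfl | h1
  · norm_num
    linear_combination coef u 1 * h2 - coef u 1 * hs
  rcases eq_or_ne n (-1) with rfl | h3
  · norm_num
    linear_combination coef u (-1) * h2 - coef u (-1) * hs
  · simp [h1, h3]

/-- The operator with the matrix `ellipseMatrix`. -/
def ellipseOp : H ≃ₗ[ℂ] H :=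
  -- In the basis ẽ, where ẽ₋₁ = -i e^{-iθ}, the off-diagonal value -1 becomes the entries i and -i.
  LinearEquiv.ofLinearMap (hyperbolicLin (-1)) (hyperbolicLin 1)
    (by simpa using hyperbolicLin_comp (s := -1) (by norm_num))
    (hyperbolicLin_comp (s := 1) (by norm_num))

lemma ellipseOp_toLinearMap : ellipseOp.toLinearMap = hyperbolicLin (-1) := rfl

lemma isRealOp_hyperbolicLin : IsRealOp (hyperbolicLin (-1)) := by
  refine fun u => ext_coef fun n => ?_
  rw [coef_conjH, coef_hyperbolicLin, coef_hyperbolicLin, coef_conjH, coef_conjH]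
  rcases eq_or_ne n 1 with rfl | h1
  · norm_num
  rcases eq_or_ne n (-1) with rfl | h3
  · norm_num
  · have h1' : -n ≠ 1 := by omega
    have h3' : -n ≠ -1 := by omega
    rw [if_neg h1, if_neg h3, if_neg h1', if_neg h3', coef_conjH]
    simp

/-- The two series differ only at n = ±1, where the difference cancels because the determinant is 1.
-/
lemma preservesOmega_hyperbolicLin : PreservesOmega (hyperbolicLin (-1)) := by
  intro u v
  have h1 := (hasSum_omega_coef (hyperbolicLin (-1) u) (hyperbolicLin (-1) v)).sub
    (hasSum_omega_coef u v)
  have h2 := hasSum_sum_of_ne_finset_zero (L := .unconditional ℤ) (f := fun n : ℤ =>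
    -((n : ℂ) * Complex.I) * coef (hyperbolicLin (-1) u) n * coef (hyperbolicLin (-1) v) (-n) -
      -((n : ℂ) * Complex.I) * coef u n * coef v (-n)) (s := {1, -1}) (fun n hn => by
      have hn1 : n ≠ 1 := fun h => hn (by simp [h])
      have hn2 : n ≠ -1 := fun h => hn (by simp [h])
      have hn1' : -n ≠ 1 := by omega
      have hn2' : -n ≠ -1 := by omega
      simp only [coef_hyperbolicLin, if_neg hn1, if_neg hn2, if_neg hn1', if_neg hn2', sub_self])
  refine sub_eq_zero.1 ((h1.unique h2).trans ?_)
  rw [Finset.sum_pair (by norm_num)]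
  simp only [coef_hyperbolicLin]
  norm_num
  linear_combination
    Complex.I * (coef u (-1) * coef v 1 - coef u 1 * coef v (-1)) * sqrt_two_mul_self

lemma offDiagonalHilbertSchmidt_hyperbolicLin :
    OffDiagonalHilbertSchmidt (hyperbolicLin (-1)) := by
  rw [summable_block_iff]
  refine summable_of_ne_finset_zero (s := {(⟨idxOne, by decide⟩, ⟨idxNegOne, by decide⟩)}) ?_
  rintro ⟨⟨m, hm⟩, ⟨n, hn⟩⟩ hmn
  have hne : n.1 ≠ m.1 := by omega
  have h1 : n.1 ≠ 1 := by omega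
  have h2 : m.1 ≠ -1 := by omega
  have h3 : m.1 = 1 → n.1 ≠ -1 := by
    intro hm1 hn1
    refine hmn (Finset.mem_singleton.2 ?_)
    exact Prod.ext (Subtype.ext (Subtype.ext hm1)) (Subtype.ext (Subtype.ext hn1))
  simp only [coef_hyperbolicLin, coef_eHat, if_neg hne, if_neg h1, if_neg h2]
  by_cases hm1 : m.1 = 1
  · simp [hm1, h3 hm1]
  · simp [hm1]

lemma ellipseOp_mem : ellipseOp ∈ spSubgroup :=
  mem_SpInf_iff.2 ⟨isRealOp_hyperbolicLin, preservesOmega_hyperbolicLin,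
    offDiagonalHilbertSchmidt_hyperbolicLin⟩

lemma conj_tildeScale_mul_self (n : NZ) :
    (starRingEnd ℂ) (tildeScale n) * tildeScale n * ((|(n.1 : ℝ)| : ℝ) : ℂ) = 1 := by
  rw [mul_comm ((starRingEnd ℂ) _), Complex.mul_conj, Complex.normSq_eq_norm_sq,
    norm_tildeScale_sq, ← Complex.ofReal_mul, one_div_mul_cancel (abs_cast_pos n).ne',
    Complex.ofReal_one]

lemma tildeScale_idxOne : tildeScale idxOne = 1 := by
  simp [tildeScale, idxOne]

lemma tildeScale_idxNegOne : tildeScale idxNegOne = -Complex.I := by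
  simp [tildeScale, idxNegOne]

lemma matrixEntry_ellipseOp (m n : NZ) :
    matrixEntry ellipseOp.toLinearMap m n = ellipseMatrix m n := by
  rw [matrixEntry_eq, ellipseOp_toLinearMap, coef_hyperbolicLin, coef_eHat, coef_eHat, coef_eHat,
    ellipseMatrix]
  have hone : ∀ k : NZ, k = idxOne ↔ k.1 = 1 := fun k => Subtype.ext_iff
  have hneg : ∀ k : NZ, k = idxNegOne ↔ k.1 = -1 := fun k => Subtype.ext_iff
  by_cases hmn : m = n
  · subst hmn
    rw [conj_tildeScale_mul_self]
    simp only [hone, hneg]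
    by_cases h1 : m.1 = 1
    · simp [h1]
    by_cases h2 : m.1 = -1
    · simp [h2]
    · simp [h1, h2]
  · have hmn' : n.1 ≠ m.1 := fun h => hmn (Subtype.ext h.symm)
    rw [if_neg hmn]
    by_cases h1 : m.1 = 1
    · by_cases h2 : n.1 = -1
      · rw [(hone m).2 h1, (hneg n).2 h2, tildeScale_idxOne, tildeScale_idxNegOne]
        simp [idxOne, idxNegOne]
      · have h3 : n.1 ≠ 1 := fun h => hmn' (h.trans h1.symm)
        simp [hone, hneg, h1, h2, h3]
    by_cases h1' : m.1 = -1
    · by_cases h2 : n.1 = 1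
      · rw [(hneg m).2 h1', (hone n).2 h2, tildeScale_idxOne, tildeScale_idxNegOne]
        simp [idxOne, idxNegOne]
      · have h3 : n.1 ≠ -1 := fun h => hmn' (h.trans h1'.symm)
        simp [hone, hneg, h1', h2, h3]
    · simp [hone, hneg, h1, h1', hmn']

lemma ellipseOp_eHat_apply (z : Circle) : (ellipseOp (eHat idxOne)).1 z =
    ⟨(Real.sqrt 2 - 1) * (z : ℂ).re, (Real.sqrt 2 + 1) * (z : ℂ).im⟩ := by
  have h : ellipseOp (eHat idxOne) =
      (Real.sqrt 2 : ℂ) • eHat idxOne + (-1 : ℂ) • eHat idxNegOne := by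
    refine ext_coef fun n => ?_
    change coef (hyperbolicLin (-1) (eHat idxOne)) n = _
    rw [coef_hyperbolicLin, coef_add, coef_smul, coef_smul]
    simp only [coef_eHat, idxOne, idxNegOne]
    rcases eq_or_ne n 1 with rfl | h1
    · norm_num
    rcases eq_or_ne n (-1) with rfl | h2
    · norm_num
    · simp [h1, h2, Ne.symm h1, Ne.symm h2]
  have h2 : (ellipseOp (eHat idxOne)).1 z = (Real.sqrt 2 : ℂ) * z - (starRingEnd ℂ) (z : ℂ) := by
    rw [h]
    change (Real.sqrt 2 : ℂ) * (z : ℂ) ^ (1 : ℤ) + (-1) * (z : ℂ) ^ (-1 : ℤ) = _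
    rw [zpow_one, zpow_neg_one, ← Circle.coe_inv, Circle.coe_inv_eq_conj]
    ring
  rw [h2]
  apply Complex.ext
  · simp
    ring
  · simp
    ring

lemma one_lt_sqrt_two : 1 < Real.sqrt 2 := by
  rw [Real.lt_sqrt] <;> norm_num

lemma range_ellipseOp : Set.range (ellipseOp (eHat idxOne)).1 = ellipse := by
  have h1 : Real.sqrt 2 - 1 ≠ 0 := (sub_pos.2 one_lt_sqrt_two).ne'
  have h2 : Real.sqrt 2 + 1 ≠ 0 := by positivity
  ext w
  simp only [Set.mem_range, ellipse, Set.mem_ofPred_eq, ellipseOp_eHat_apply]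
  constructor
  · rintro ⟨z, rfl⟩
    have hz := Circle.normSq_coe z
    rw [Complex.normSq_apply] at hz
    simp only
    rw [mul_pow, mul_pow, mul_div_cancel_left₀ _ (pow_ne_zero 2 h1),
      mul_div_cancel_left₀ _ (pow_ne_zero 2 h2)]
    linarith
  · intro hw
    have hz : (⟨w.re / (Real.sqrt 2 - 1), w.im / (Real.sqrt 2 + 1)⟩ : ℂ) ∈
        Submonoid.unitSphere ℂ := by
      refine mem_sphere_zero_iff_norm.2 ?_
      have : ‖(⟨w.re / (Real.sqrt 2 - 1), w.im / (Real.sqrt 2 + 1)⟩ : ℂ)‖ ^ 2 = 1 := by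
        rw [← Complex.normSq_eq_norm_sq, Complex.normSq_mk, ← sq, ← sq, div_pow, div_pow, hw]
      exact (pow_eq_one_iff_of_nonneg (norm_nonneg _) two_ne_zero).1 this
    refine ⟨⟨_, hz⟩, ?_⟩
    apply Complex.ext
    · change (Real.sqrt 2 - 1) * (w.re / (Real.sqrt 2 - 1)) = w.re
      field_simp
    · change (Real.sqrt 2 + 1) * (w.im / (Real.sqrt 2 + 1)) = w.im
      field_simp

/-- The points ±i(√2 + 1) of the ellipse are farther apart than the diameter 2 of the circle. -/
lemma ellipse_ne_sphere (c : ℂ) : ellipse ≠ Metric.sphere c 1 := by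
  intro h
  have h2 : Real.sqrt 2 + 1 ≠ 0 := by positivity
  have hp : (⟨0, Real.sqrt 2 + 1⟩ : ℂ) ∈ Metric.sphere c 1 := by
    rw [← h]
    simp [ellipse, h2]
  have hm : (⟨0, -(Real.sqrt 2 + 1)⟩ : ℂ) ∈ Metric.sphere c 1 := by
    rw [← h]
    simp only [ellipse, Set.mem_ofPred_eq, neg_sq]
    simp [h2]
  rw [Metric.mem_sphere] at hp hm
  have hd := dist_triangle_right (⟨0, Real.sqrt 2 + 1⟩ : ℂ) ⟨0, -(Real.sqrt 2 + 1)⟩ c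
  rw [hp, hm, Complex.dist_of_re_eq (by rfl), Real.dist_eq] at hd
  have h3 := (le_abs_self _).trans hd
  have h4 := one_lt_sqrt_two
  simp only at h3
  linarith

lemma ellipseOp_notMem_range :
    (⟨ellipseOp, ellipseOp_mem⟩ : spSubgroup) ∉ Set.range diffHom := by
  rintro ⟨φ, hφ⟩
  obtain ⟨c, hc⟩ := range_diffAct φ
  refine ellipse_ne_sphere c ?_
  rw [← hc, ← range_ellipseOp]
  exact congrArg (fun A : spSubgroup => Set.range ((A : H ≃ₗ[ℂ] H) (eHat idxOne)).1) hφ.symm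

end SymplecticCircle
end

open SymplecticCircle
theorem theorem4p6 :
    ∃ Sp : Subgroup (H ≃ₗ[ℂ] H), (Sp : Set (H ≃ₗ[ℂ] H)) = SpInf ∧
      ∃ Φ : DiffS1 →* Sp,
        (∀ (φ : DiffS1) (u : H), (((Φ φ : H ≃ₗ[ℂ] H) u : H) : Circle → ℂ) = diffAct φ u) ∧
        Function.Injective Φ ∧
        ¬ Function.Surjective Φ ∧
        (∀ φ : DiffS1, ∃ c : ℂ,
          Set.range (((Φ φ : H ≃ₗ[ℂ] H) (eHat idxOne) : H) : Circle → ℂ) = Metric.sphere c 1) ∧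
        ∃ A : Sp,
          (∀ m n : NZ, matrixEntry (A : H ≃ₗ[ℂ] H).toLinearMap m n = ellipseMatrix m n) ∧
          Set.range (((A : H ≃ₗ[ℂ] H) (eHat idxOne) : H) : Circle → ℂ) = ellipse ∧
          (∀ c : ℂ, ellipse ≠ Metric.sphere c 1) ∧
          A ∉ Set.range Φ :=
  ⟨spSubgroup, rfl, diffHom, fun _ _ => rfl, diffHom_injective,
    fun h => ellipseOp_notMem_range (h _), range_diffAct,
    ⟨ellipseOp, ellipseOp_mem⟩, matrixEntry_ellipseOp, range_ellipseOp, ellipse_ne_sphere,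
    ellipseOp_notMem_range⟩
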